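/- Let $\mathcal Y\subset\mathbb R$, let $P$ be the law of a pair $(X,Y)\in\mathbb R^d\times\mathcal Y$, and let $\Theta\subset\mathbb R^d$ be convex and compact with $0\in\Theta$ and (Euclidean) diameter $\Delta$. Let $\ell:\mathbb R\times\mathcal Y\to\mathbb R_+$ be a measurable loss such that, for every $y\in\mathcal Y$, $z\mapsto\ell(z,y)$ is convex, differentiable and $\gamma$-smooth, i.e. $|\ell'(z,y)-\ell'(z',y)|\le\gamma|z-z'|$ with $\ell'=\partial\ell/\partial z$, and such that for some $q\in[1,2]$ and positive constants $C_1,C_2,C_1',C_2'$, $$|\ell(z,y)|\le C_1+C_2|z-y|^q,\qquad |\ell'(z,y)|\le C_1'+C_2'|z-y|^{q-1}\qquad (z\in\mathbb R,\ y\in\mathcal Y).$$ Let $\alpha\in(0,1]$ and assume that for every $j\in\{1,\dots,d\}$, $$\mathbb E|X^j|^{\max(2,q(1+\alpha))}<\infty,\qquad \mathbb E\big(|Y|^{q-1}|X^j|\big)^{1+\alpha}<\infty,\qquad \mathbb E|Y|^q<\infty .$$ Let $n$ be even and let $(X_i,Y_i)_{i=1}^n$ be data whose index set $\{1,\dots,n\}$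 is the disjoint union of a set $\mathcal I$ of inliers and a set $\mathcal O$ of outliers, where $|\mathcal I|>|\mathcal O|$, $|\mathcal O|\le\eta n$ with $\eta\in[0,1/2)$, the pairs $(X_i,Y_i)_{i\in\mathcal I}$ are i.i.d. with law $P$, and the pairs $(X_i,Y_i)_{i\in\mathcal O}$ are arbitrary. Write $R(\theta)=\mathbb E[\ell(X^\top\theta,Y)]$, $g_j(\theta)=\partial R(\theta)/\partial\theta_j$ and $g_j^i(\theta)=\ell'(X_i^\top\theta,Y_i)X_i^j$, and put $$M_{j,\alpha}=\sup_{\theta\in\Theta}\mathbb E\Big[\big|\ell'(X^\top\theta,Y)X^j-\mathbb E[\ell'(X^\top\theta,Y)X^j]\big|^{1+\alpha}\Big],\quad \overline L=\gamma\,\mathbb E\|X\|^2,\quad m_{L,\alpha}=\mathbb E\big|\gamma\|X\|^2-\overline L\big|^{1+\alpha}\in[0,\infty].$$ Let $L_j>0$ be a constant with $|g_j(\theta+he_j)-g_j(\theta)|\le L_j|h|$ whenever $\theta\in\Theta$ and $\theta+he_j\in\Theta$. Fix $\delta\in(0,1)$ and put $$\Lambda=\frac{\log(4d/\delta)+d\log\big(3\Delta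 n^{\alpha/(1+\alpha)}/2\big)}{n},\qquad \epsilon=8\eta+12\Lambda .$$ Let $\widehat g_j^{\mathtt{TM}}(\theta)$ be the trimmed (winsorized) mean estimator with proportion $\epsilon$, $$\widehat g_j^{\mathtt{TM}}(\theta)=\frac2n\sum_{i=n/2+1}^{n}\max\big(q_\epsilon,\min(g_j^i(\theta),q_{1-\epsilon})\big),$$ where $q_\epsilon$ and $q_{1-\epsilon}$ are the $\lfloor\epsilon n/2\rfloor$-th and the $\lfloor(1-\epsilon)n/2\rfloor$-th smallest of the values $g_j^1(\theta),\dots,g_j^{n/2}(\theta)$. Assume that $\epsilon<1/2$ and that $n^{-\alpha/(1+\alpha)}\le\Delta/2$. Then, for every $j\in\{1,\dots,d\}$, with probability at least $1-\delta$, $$\sup_{\theta\in\Theta}\big|\widehat g_j^{\mathtt{TM}}(\theta)-g_j(\theta)\big|\le 28\Big(M_{j,\alpha}+\frac{m_{L,\alpha}}{n^{\alpha(1+\alpha)}}\Big)^{\frac1{1+\alpha}}\big(2\eta+3\Lambda\big)^{\frac{\alpha}{1+\alpha}}+\frac{\overline L+L_j}{n^{\alpha/(1+\alpha)}} .$$ 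-/

import Mathlib

open MeasureTheory ProbabilityTheory
open scoped ENNReal

noncomputable section

namespace TrimmedGradient

/-- Feature vectors and parameters: `ℝ^d` with the Euclidean norm. -/
abbrev Vec (d : ℕ) : Type := EuclideanSpace ℝ (Fin d)

/-! ### Loss, risk and partial derivatives -/

/-- `ℓ'(z, y) = ∂ℓ(z, y)/∂z`. -/
def lossDeriv {𝒴 : Set ℝ} (ℓ : ℝ → 𝒴 → ℝ) (z : ℝ) (y : 𝒴) : ℝ :=
  deriv (fun t => ℓ t y) z

/-- The assumptions on the loss `ℓ : ℝ × 𝒴 → ℝ₊`: it is measurable, nonnegative, and, in its first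
variable, convex, differentiable and `γ`-smooth; `ℓ` and `ℓ'` grow polynomially, with asymptotic
degrees `q ∈ [1, 2]` and `q - 1`. -/
structure LossAssumption {𝒴 : Set ℝ} (ℓ : ℝ → 𝒴 → ℝ) (γ q : ℝ) : Prop where
  measurable : Measurable (fun p : ℝ × 𝒴 => ℓ p.1 p.2)
  nonneg : ∀ z y, 0 ≤ ℓ z y
  convex : ∀ y, ConvexOn ℝ Set.univ (fun z => ℓ z y)
  differentiable : ∀ y, Differentiable ℝ (fun z => ℓ z y)
  smooth : ∀ z z' y, |lossDeriv ℓ z y - lossDeriv ℓ z' y| ≤ γ * |z - z'|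
  one_le_degree : 1 ≤ q
  degree_le_two : q ≤ 2
  growth : ∃ C₁ C₂ : ℝ, 0 < C₁ ∧ 0 < C₂ ∧
    ∀ (z : ℝ) (y : 𝒴), |ℓ z y| ≤ C₁ + C₂ * |z - (y : ℝ)| ^ q
  deriv_growth : ∃ C₁ C₂ : ℝ, 0 < C₁ ∧ 0 < C₂ ∧
    ∀ (z : ℝ) (y : 𝒴), |lossDeriv ℓ z y| ≤ C₁ + C₂ * |z - (y : ℝ)| ^ (q - 1)

/-- The risk `R(θ) = E[ℓ(Xᵀθ, Y)]`, where `(X, Y)` has law `P`. -/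
def risk {d : ℕ} {𝒴 : Set ℝ} (ℓ : ℝ → 𝒴 → ℝ) (P : Measure (Vec d × 𝒴)) (θ : Vec d) : ℝ :=
  ∫ w, ℓ (inner ℝ w.1 θ) w.2 ∂P

/-- The partial derivative `g_j(θ) = ∂R(θ)/∂θ_j` of the risk. -/
def riskPartial {d : ℕ} {𝒴 : Set ℝ} (ℓ : ℝ → 𝒴 → ℝ) (P : Measure (Vec d × 𝒴)) (j : Fin d)
    (θ : Vec d) : ℝ :=
  lineDeriv ℝ (risk ℓ P) θ (EuclideanSpace.single j 1)

/-- The sample partial derivative `ℓ'(xᵀθ, y) x^j` at the data point `w = (x, y)`. -/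
def samplePartial {d : ℕ} {𝒴 : Set ℝ} (ℓ : ℝ → 𝒴 → ℝ) (j : Fin d) (θ : Vec d)
    (w : Vec d × 𝒴) : ℝ :=
  lossDeriv ℓ (inner ℝ w.1 θ) w.2 * w.1 j

/-- `C` is a Lipschitz constant on `Θ` of `g_j` in the direction of its own coordinate `j`. -/
def IsCoordLipschitz {d : ℕ} {𝒴 : Set ℝ} (ℓ : ℝ → 𝒴 → ℝ) (P : Measure (Vec d × 𝒴))
    (Θ : Set (Vec d)) (j : Fin d) (C : ℝ) : Prop :=
  ∀ θ ∈ Θ, ∀ h : ℝ, θ + h • EuclideanSpace.single j (1 : ℝ) ∈ Θ →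
    |riskPartial ℓ P j (θ + h • EuclideanSpace.single j (1 : ℝ)) - riskPartial ℓ P j θ| ≤ C * |h|

/-! ### The data -/

/-- The assumptions on the data `Z_i = (X_i, Y_i)`, `i ∈ Fin n`: the index set is split into
inliers and outliers with more inliers than outliers, the inliers are i.i.d. with law `P`, nothing
at all is assumed on the outliers, and `P` has the required moments. -/
structure DataAssumption {d n : ℕ} {𝒴 : Set ℝ} {Ω : Type*} [MeasurableSpace Ω] (μ : Measure Ω)
    (P : Measure (Vec d × 𝒴)) (Z : Fin n → Ω → Vec d × 𝒴) (inliers outliers : Finset (Fin n))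
    (q α : ℝ) : Prop where
  disjoint : Disjoint inliers outliers
  union : inliers ∪ outliers = Finset.univ
  card_lt : outliers.card < inliers.card
  measurable : ∀ i ∈ inliers, Measurable (Z i)
  law : ∀ i ∈ inliers, μ.map (Z i) = P
  indep : iIndepFun (fun i : inliers => Z i) μ
  moment_feature : ∀ j : Fin d, Integrable (fun w => |w.1 j| ^ max 2 (q * (α + 1))) P
  moment_product : ∀ j : Fin d,
    Integrable (fun w => (|(w.2 : ℝ)| ^ (q - 1) * |w.1 j|) ^ (1 + α)) P
  moment_label : Integrable (fun w => |(w.2 : ℝ)| ^ q) P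

/-! ### Moments -/

/-- The centered moment `m_{α,j}(θ)` of order `1 + α` of `ℓ'(Xᵀθ, Y) X^j`, in `[0, ∞]`. -/
def partialMoment {d : ℕ} {𝒴 : Set ℝ} (ℓ : ℝ → 𝒴 → ℝ) (P : Measure (Vec d × 𝒴)) (α : ℝ)
    (j : Fin d) (θ : Vec d) : ℝ≥0∞ :=
  ∫⁻ w, ENNReal.ofReal
    (|samplePartial ℓ j θ w - ∫ w', samplePartial ℓ j θ w' ∂P| ^ (1 + α)) ∂P

/-- `M_{α,j}`, the supremum of `m_{α,j}` over `Θ`. -/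
def maxPartialMoment {d : ℕ} {𝒴 : Set ℝ} (ℓ : ℝ → 𝒴 → ℝ) (P : Measure (Vec d × 𝒴))
    (Θ : Set (Vec d)) (α : ℝ) (j : Fin d) : ℝ≥0∞ :=
  ⨆ θ ∈ Θ, partialMoment ℓ P α j θ

/-- `L̄ = γ E‖X‖²`. -/
def meanSmoothness {d : ℕ} {𝒴 : Set ℝ} (P : Measure (Vec d × 𝒴)) (γ : ℝ) : ℝ :=
  γ * ∫ w, ‖w.1‖ ^ 2 ∂P

/-- `m_{L,α} = E|γ‖X‖² - L̄|^{1+α}`, in `[0, ∞]`. -/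
def smoothnessMoment {d : ℕ} {𝒴 : Set ℝ} (P : Measure (Vec d × 𝒴)) (γ α : ℝ) : ℝ≥0∞ :=
  ∫⁻ w, ENNReal.ofReal (|γ * ‖w.1‖ ^ 2 - meanSmoothness P γ| ^ (1 + α)) ∂P

/-! ### The trimmed (winsorized) mean estimator -/

/-- The `k`-th smallest entry of `v`, for `1 ≤ k ≤ m` (`0` if `k > m`). -/
def orderStat {m : ℕ} (v : Fin m → ℝ) (k : ℕ) : ℝ :=
  if h : k - 1 < m then v (Tuple.sort v ⟨k - 1, h⟩) else 0

/-- The entries of `v` with index in the first half. -/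
def firstHalf {n : ℕ} (v : Fin n → ℝ) : Fin (n / 2) → ℝ :=
  fun i => v (Fin.castLE (Nat.div_le_self n 2) i)

/-- The trimmed mean of `v` with proportion `ε`: the average over the second half of the entries,
clipped between the `ε` and `1 - ε` empirical quantiles of the first half. -/
def trimmedMean {n : ℕ} (ε : ℝ) (v : Fin n → ℝ) : ℝ :=
  2 / (n : ℝ) * ∑ i : Fin n with n / 2 ≤ i.val,
    max (orderStat (firstHalf v) ⌊ε * n / 2⌋₊)
      (min (v i) (orderStat (firstHalf v) ⌊(1 - ε) * n / 2⌋₊))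

/-- The trimmed mean estimator `ĝ_j(θ)` of `g_j(θ)` computed from the data points `z`. -/
def gradTM {d n : ℕ} {𝒴 : Set ℝ} (ℓ : ℝ → 𝒴 → ℝ) (ε : ℝ) (z : Fin n → Vec d × 𝒴) (j : Fin d)
    (θ : Vec d) : ℝ :=
  trimmedMean ε (fun i => samplePartial ℓ j θ (z i))

/-! ### Level of trimming and error bound -/

/-- `(log(4d/δ) + d log(3 Δ n^{α/(1+α)} / 2)) / n`. -/
def complexityTerm (d n : ℕ) (Δ α δ : ℝ) : ℝ :=
  (Real.log (4 * d / δ) + d * Real.log (3 * Δ * (n : ℝ) ^ (α / (1 + α)) / 2)) / n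

/-- The trimming proportion
`ε = 8η + 12 (log(4d/δ) + d log(3 Δ n^{α/(1+α)} / 2)) / n`. -/
def trimLevel (d n : ℕ) (Δ α δ η : ℝ) : ℝ :=
  8 * η + 12 * complexityTerm d n Δ α δ

/-- The error `ε_j^TM(δ)`, in `[0, ∞]`. -/
def errorTM {d : ℕ} {𝒴 : Set ℝ} (n : ℕ) (ℓ : ℝ → 𝒴 → ℝ) (P : Measure (Vec d × 𝒴))
    (Θ : Set (Vec d)) (γ α δ η L : ℝ) (j : Fin d) : ℝ≥0∞ :=
  28 * (maxPartialMoment ℓ P Θ α j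
        + smoothnessMoment P γ α / (n : ℝ≥0∞) ^ (α * (1 + α))) ^ (1 / (1 + α))
      * ENNReal.ofReal (2 * η + 3 * complexityTerm d n (Metric.diam Θ) α δ) ^ (α / (1 + α))
    + ENNReal.ofReal ((meanSmoothness P γ + L) / (n : ℝ) ^ (α / (1 + α)))

end TrimmedGradient

end

/-! Write `β = α / (1 + α)`, `ρ = n ^ β`, and let `u` be `n` times the complexity term, so that `ε *
(n / 2) = 4ηn + 6u`. Fix a parameter `θ₀`. By smoothness of the loss, for every `θ` within `r` of
`θ₀` the sample partial derivative moves by at most the envelope `V = γ‖X‖²r`. Hence, over the whole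
ball at once, the inlier values centred at `g_j(θ₀)` lie between `U - V` and `U + V`, where `U` is
the centred derivative at `θ₀`. Clipping is monotone, so both deviations reduce to one upper bound
for a clipped sum of `±U + V` (`exists_event_sum_clamp_le`). Of `V` only the mean is used, so the
moment of `γ‖X‖²` of order `1 + α` is not needed for the estimate: it only enlarges the stated
bound.

For the one-sided bound, the random clipping levels are replaced by fixed ones `A ≤ B`
(`sum_clamp_le_sum_clamp`). If the random upper level exceeded `B`, too many first-half values would
exceed `B`, although the outliers are fewer than the trimmed values and few inliers exceed `B`; the
lower level is handled in the same way. Each second-half outlier then costs at most `B`, and the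
inlier sum is controlled by Bernstein's inequality, since the variance of the clipped variable is of
order `ε B²`. With `B` a tail level of order `ε` one has `ε B ≲ m ε^β + v`, where `m` bounds the
`L^{1+α}` norm of `U` and `v` the mean of `V`. The clipping bias has the same order.

The good events involve inliers only, so they are measurable although the outliers are arbitrary.
Each centre fails with probability at most `6 exp(-5u)`. A net of `Θ` of radius `1 / (60ρ)` has at
most `(1 + 120Δρ)^d` points, and the factor `5` in the exponent pays for the union bound. Passing
from the net to `Θ` costs only multiples of `v`, which fit in `(L̄ + L_j) / ρ`. -/

namespace TrimmedGradient

/-! ### Nets of bounded sets -/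

open scoped Function in
/-- An `r`-separated set in a ball of radius `R` has at most `(1 + 2R/r)^dim` elements. -/
theorem card_le_of_separated {E : Type*} [NormedAddCommGroup E] [NormedSpace ℝ E]
    [FiniteDimensional ℝ E] {R r : ℝ} (hR : 0 ≤ R) (hr : 0 < r) (s : Finset E)
    (hs : ∀ c ∈ s, ‖c‖ ≤ R) (h : ∀ c ∈ s, ∀ d ∈ s, c ≠ d → r ≤ ‖c - d‖) :
    (s.card : ℝ) ≤ (1 + 2 * R / r) ^ Module.finrank ℝ E := by
  borelize E
  let μ : Measure E := Measure.addHaar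
  have δpos : 0 < r / 2 := by positivity
  have ρpos : 0 < R + r / 2 := by positivity
  -- Volume comparison: the balls of radius `r / 2` are disjoint and contained in the ball of radius
  -- `R + r / 2`.
  set A := ⋃ c ∈ s, Metric.ball (c : E) (r / 2) with hA
  have D : Set.Pairwise (s : Set E) (Disjoint on fun c => Metric.ball (c : E) (r / 2)) := by
    rintro c hc d hd hcd
    apply Metric.ball_disjoint_ball
    rw [dist_eq_norm, add_halves]
    exact h c hc d hd hcd
  have A_subset : A ⊆ Metric.ball (0 : E) (R + r / 2) := by
    refine Set.iUnion₂_subset fun x hx => ?_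
    apply Metric.ball_subset_ball'
    rw [dist_zero_right, add_comm]
    gcongr
    exact hs x hx
  have I : (s.card : ℝ≥0∞) * ENNReal.ofReal ((r / 2) ^ Module.finrank ℝ E) * μ (Metric.ball 0 1) ≤
      ENNReal.ofReal ((R + r / 2) ^ Module.finrank ℝ E) * μ (Metric.ball 0 1) :=
    calc
      _ = μ A := by
        rw [hA, measure_biUnion_finset D fun c _ => measurableSet_ball]
        simp only [μ.addHaar_ball_of_pos _ δpos]
        simp only [Finset.sum_const, nsmul_eq_mul, mul_assoc]
      _ ≤ μ (Metric.ball (0 : E) (R + r / 2)) := measure_mono A_subset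
      _ = _ := by simp only [μ.addHaar_ball_of_pos _ ρpos]
  have J : (s.card : ℝ≥0∞) * ENNReal.ofReal ((r / 2) ^ Module.finrank ℝ E) ≤
      ENNReal.ofReal ((R + r / 2) ^ Module.finrank ℝ E) :=
    (ENNReal.mul_le_mul_iff_left (Metric.measure_ball_pos _ _ zero_lt_one).ne'
      measure_ball_lt_top.ne).1 I
  have K := ENNReal.toReal_le_of_le_ofReal (pow_nonneg ρpos.le _) J
  rw [ENNReal.toReal_mul, ENNReal.toReal_natCast, ENNReal.toReal_ofReal (by positivity),
    ← le_div_iff₀ (by positivity), ← div_pow] at K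
  convert! K using 2
  field_simp
  ring

/-- A subset of a ball of radius `R` has an `r`-net with at most `(1 + 2R/r)^dim` elements. -/
theorem exists_finset_net {E : Type*} [NormedAddCommGroup E] [NormedSpace ℝ E]
    [FiniteDimensional ℝ E] {R r : ℝ} (hR : 0 ≤ R) (hr : 0 < r) (Θ : Set E)
    (hΘ : ∀ θ ∈ Θ, ‖θ‖ ≤ R) :
    ∃ T : Finset E, (T : Set E) ⊆ Θ ∧ (∀ θ ∈ Θ, ∃ t ∈ T, ‖θ - t‖ ≤ r) ∧
      (T.card : ℝ) ≤ (1 + 2 * R / r) ^ Module.finrank ℝ E := by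
  classical
  -- A separated set of maximal cardinality is a net, since an uncovered point could be added. Its
  -- points lie in `Θ`, where the moment bounds hold.
  let p : ℕ → Prop := fun k => ∃ T : Finset E, (T : Set E) ⊆ Θ ∧
    (∀ c ∈ T, ∀ d ∈ T, c ≠ d → r ≤ ‖c - d‖) ∧ T.card = k
  have hp : ∀ k, p k → k ≤ ⌊(1 + 2 * R / r) ^ Module.finrank ℝ E⌋₊ := by
    rintro _ ⟨T, hT, hsep, rfl⟩
    exact Nat.le_floor (card_le_of_separated hR hr T (fun c hc => hΘ c (hT hc)) hsep)
  have hp0 : p 0 := ⟨∅, by simp, by simp, rfl⟩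
  obtain ⟨T, hT, hsep, hcard⟩ := Nat.findGreatest_spec (P := p) (Nat.zero_le
    ⌊(1 + 2 * R / r) ^ Module.finrank ℝ E⌋₊) hp0
  refine ⟨T, hT, fun θ hθ => ?_, card_le_of_separated hR hr T (fun c hc => hΘ c (hT hc)) hsep⟩
  by_contra! hcon
  have hnot : θ ∉ T := fun hmem => by simpa using (hr.trans (hcon θ hmem))
  have hins : p (T.card + 1) := by
    refine ⟨insert θ T, ?_, ?_, Finset.card_insert_of_notMem hnot⟩
    · rw [Finset.coe_insert]
      exact Set.insert_subset hθ hT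
    · intro c hc d hd hcd
      rw [Finset.mem_insert] at hc hd
      rcases hc with rfl | hc <;> rcases hd with rfl | hd
      · exact absurd rfl hcd
      · exact (hcon d hd).le
      · rw [norm_sub_rev]
        exact (hcon c hc).le
      · exact hsep c hc d hd hcd
  have := Nat.le_findGreatest (P := p) (hp _ hins) hins
  omega

/-! ### Order statistics -/

/-- If the `k`-th smallest entry exceeds `t`, then at least `m - k + 1` entries do. -/
theorem card_lt_of_lt_orderStat {m : ℕ} (v : Fin m → ℝ) {k : ℕ} (hk : 1 ≤ k) (hkm : k ≤ m) {t : ℝ}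
    (h : t < orderStat v k) : m + 1 ≤ (Finset.univ.filter fun i => t < v i).card + k := by
  have hk' : k - 1 < m := by omega
  rw [orderStat, dif_pos hk'] at h
  have hsub : (Finset.Ici (⟨k - 1, hk'⟩ : Fin m)).map (Tuple.sort v).toEmbedding ⊆
      Finset.univ.filter fun i => t < v i := by
    intro i hi
    rw [Finset.mem_map] at hi
    obtain ⟨a, ha, rfl⟩ := hi
    rw [Finset.mem_Ici] at ha
    simpa using h.trans_le (Tuple.monotone_sort v ha)
  have := Finset.card_le_card hsub
  rw [Finset.card_map, Fin.card_Ici] at this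
  simp only at this
  omega

/-- If the `k`-th smallest entry is less than `t`, then at least `k` entries are. -/
theorem card_lt_of_orderStat_lt {m : ℕ} (v : Fin m → ℝ) {k : ℕ} (hk : 1 ≤ k) (hkm : k ≤ m) {t : ℝ}
    (h : orderStat v k < t) : k ≤ (Finset.univ.filter fun i => v i < t).card := by
  have hk' : k - 1 < m := by omega
  rw [orderStat, dif_pos hk'] at h
  have hsub : (Finset.Iic (⟨k - 1, hk'⟩ : Fin m)).map (Tuple.sort v).toEmbedding ⊆
      Finset.univ.filter fun i => v i < t := by
    intro i hi
    rw [Finset.mem_map] at hi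
    obtain ⟨a, ha, rfl⟩ := hi
    rw [Finset.mem_Iic] at ha
    simpa using (Tuple.monotone_sort v ha).trans_lt h
  have := Finset.card_le_card hsub
  rw [Finset.card_map, Fin.card_Iic] at this
  simp only at this
  omega

theorem card_filter_firstHalf {n : ℕ} (v : Fin n → ℝ) (p : ℝ → Prop) [DecidablePred p] :
    (Finset.univ.filter fun i => p (firstHalf v i)).card =
      (Finset.univ.filter fun i : Fin n => i.val < n / 2 ∧ p (v i)).card := by
  rw [← Finset.card_map (Fin.castLEEmb (Nat.div_le_self n 2))]
  congr 1
  ext i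
  rw [Finset.mem_map, Finset.mem_filter]
  constructor
  · rintro ⟨a, ha, rfl⟩
    exact ⟨Finset.mem_univ _, a.2, (Finset.mem_filter.1 ha).2⟩
  · rintro ⟨-, hi, hp⟩
    exact ⟨⟨i, hi⟩, Finset.mem_filter.2 ⟨Finset.mem_univ _, hp⟩, rfl⟩

/-! ### Exponential tail bounds -/

section Tail

variable {Ω E ι : Type*} [MeasurableSpace Ω] [MeasurableSpace E] {μ : Measure Ω} {P : Measure E}

/-- Chernoff's bound for a sum of functions of i.i.d. observations. -/
theorem measure_sum_ge_le [IsProbabilityMeasure P] {Z : ι → Ω → E} {I : Finset ι}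
    (hmeas : ∀ i ∈ I, Measurable (Z i)) (hlaw : ∀ i ∈ I, μ.map (Z i) = P)
    (hind : iIndepFun (fun i : I => Z i) μ) {S : Finset ι} (hS : S ⊆ I) {F : E → ℝ}
    (hF : Measurable F) {C : ℝ} (hC : ∀ w, F w ≤ C) {κ : ℝ}
    (hκ : ∫ w, Real.exp (F w) ∂P ≤ Real.exp κ) (c : ℝ) :
    μ {ω | c ≤ ∑ i ∈ S, F (Z i ω)} ≤ ENNReal.ofReal (Real.exp (S.card * κ - c)) := by
  classical
  have : IsProbabilityMeasure μ := hind.isProbabilityMeasure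
  -- Independence is available only for the family indexed by the inliers.
  let T : Finset I := S.subtype (· ∈ I)
  have hsum : ∀ f : ι → ℝ, ∑ i ∈ S, f i = ∑ i ∈ T, f i := fun f => by
    rw [Finset.sum_subtype_of_mem (p := (· ∈ I)) f (fun i hi => hS hi)]
  have hcard : T.card = S.card := by
    rw [Finset.card_subtype, Finset.filter_true_of_mem fun i hi => hS hi]
  let X : I → Ω → ℝ := fun i ω => F (Z i ω)
  have hX : ∀ i, Measurable (X i) := fun i => hF.comp (hmeas i i.2)
  have hXi : iIndepFun X μ := hind.comp (fun _ => F) fun _ => hF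
  have hmgf : ∀ i, mgf (X i) μ 1 ≤ Real.exp κ := fun i => by
    have : mgf (X i) μ 1 = ∫ w, Real.exp (F w) ∂P := by
      rw [← hlaw i i.2, integral_map (hmeas i i.2).aemeasurable
        (hF.exp.aestronglyMeasurable), mgf]
      simp [X]
    rw [this]
    exact hκ
  have hint : Integrable (fun ω => Real.exp (1 * (∑ i ∈ T, X i) ω)) μ := by
    refine Integrable.of_bound (C := Real.exp (T.card * C)) ?_ (.of_forall fun ω => ?_)
    · simp only [Finset.sum_apply]
      exact (((Finset.measurable_sum T fun i _ => hX i).const_mul 1).exp).aestronglyMeasurable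
    · rw [Real.norm_eq_abs, Real.abs_exp, one_mul, Finset.sum_apply]
      refine Real.exp_le_exp.2 ((Finset.sum_le_sum fun i _ => hC _).trans ?_)
      simp
  have h := measure_ge_le_exp_mul_mgf (X := ∑ i ∈ T, X i) (μ := μ) c zero_le_one hint
  rw [hXi.mgf_sum hX] at h
  have hset : {ω | c ≤ ∑ i ∈ S, F (Z i ω)} = {ω | c ≤ (∑ i ∈ T, X i) ω} := by
    ext ω
    simp only [Set.mem_ofPred_eq, Finset.sum_apply, X]
    rw [hsum fun i => F (Z i ω)]
  rw [hset, ← ENNReal.ofReal_toReal (measure_ne_top μ _)]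
  refine ENNReal.ofReal_le_ofReal (h.trans ?_)
  have hprod : ∏ i ∈ T, mgf (X i) μ 1 ≤ Real.exp κ ^ S.card := by
    rw [← hcard, ← Finset.prod_const]
    exact Finset.prod_le_prod (fun i _ => mgf_nonneg) fun i _ => hmgf i
  calc Real.exp (-1 * c) * ∏ i ∈ T, mgf (X i) μ 1
      ≤ Real.exp (-1 * c) * Real.exp κ ^ S.card := by gcongr
    _ = Real.exp (S.card * κ - c) := by
      rw [← Real.exp_nat_mul, ← Real.exp_add]
      congr 1
      ring

end Tail

section Tail

variable {Ω E ι : Type*} [MeasurableSpace Ω] [MeasurableSpace E] {μ : Measure Ω} {P : Measure E}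

theorem integral_exp_ite [IsProbabilityMeasure P] {s : Set E} [DecidablePred (· ∈ s)]
    (hs : MeasurableSet s) (t : ℝ) :
    ∫ w, Real.exp (if w ∈ s then t else 0) ∂P = 1 + (Real.exp t - 1) * P.real s := by
  have : (fun w => Real.exp (if w ∈ s then t else 0)) =
      fun w => 1 + (Real.exp t - 1) * s.indicator 1 w := by
    ext w
    by_cases hw : w ∈ s <;> simp [hw]
  rw [this, integral_add (integrable_const _) (((integrable_const 1).indicator hs).const_mul _),
    integral_const_mul, integral_indicator_one hs]
  simp

/-- Chernoff's bound for the number of observations falling in a given set. -/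
theorem measure_count_ge_le [IsProbabilityMeasure P] {Z : ι → Ω → E} {I : Finset ι}
    (hmeas : ∀ i ∈ I, Measurable (Z i)) (hlaw : ∀ i ∈ I, μ.map (Z i) = P)
    (hind : iIndepFun (fun i : I => Z i) μ) {S : Finset ι} (hS : S ⊆ I) {s : Set E}
    [DecidablePred (· ∈ s)] (hs : MeasurableSet s) {t κ : ℝ}
    (hκ : 1 + (Real.exp t - 1) * P.real s ≤ Real.exp κ) (c : ℝ) :
    μ {ω | c ≤ t * (S.filter fun i => Z i ω ∈ s).card} ≤
      ENNReal.ofReal (Real.exp (S.card * κ - c)) := by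
  have hF : Measurable fun w : E => if w ∈ s then t else 0 :=
    Measurable.ite hs measurable_const measurable_const
  have := measure_sum_ge_le hmeas hlaw hind hS hF (C := max t 0)
    (fun w => by split_ifs <;> simp) (by rwa [integral_exp_ite hs]) c
  convert! this using 5 with ω
  rw [← Finset.sum_filter, Finset.sum_const, nsmul_eq_mul, mul_comm]

/-- Taylor's formula of order two: the remainder is at most `(2/9)|z|³ ≤ (2/9)z²`, and `1/2 + 2/9 <
0.7223`. -/
theorem exp_le_one_add_add_sq {z : ℝ} (hz : |z| ≤ 1) :
    Real.exp z ≤ 1 + z + 0.7223 * z ^ 2 := by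
  have h := Real.exp_bound hz (n := 3) (by norm_num)
  rw [abs_le] at h
  have h2 := h.2
  simp only [Finset.sum_range_succ, Finset.sum_range_zero, Nat.factorial] at h2
  have h3 : |z| ^ 3 ≤ z ^ 2 := by
    have : |z| ^ 3 = z ^ 2 * |z| := by rw [pow_succ, sq_abs]
    rw [this]
    exact mul_le_of_le_one_right (sq_nonneg _) hz
  norm_num at h2
  nlinarith

/-- Bernstein's bound for bounded variables with small second moment. -/
theorem integral_exp_le_of_sq_le [IsProbabilityMeasure P] {F : E → ℝ} (hF : Measurable F)
    (hF1 : ∀ w, |F w| ≤ 1) {c : ℝ} (hc : ∫ w, F w ^ 2 ∂P ≤ c) :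
    ∫ w, Real.exp (F w) ∂P ≤ Real.exp (∫ w, F w ∂P + 0.7223 * c) := by
  have hi : Integrable F P := .of_bound hF.aestronglyMeasurable 1 (.of_forall hF1)
  have hi2 : Integrable (fun w => F w ^ 2) P :=
    .of_bound (hF.pow_const 2).aestronglyMeasurable 1 (.of_forall fun w => by
      rw [Real.norm_eq_abs, abs_pow]
      exact pow_le_one₀ (abs_nonneg _) (hF1 w))
  have hie : Integrable (fun w => Real.exp (F w)) P :=
    .of_bound hF.exp.aestronglyMeasurable (Real.exp 1) (.of_forall fun w => by
      rw [Real.norm_eq_abs, Real.abs_exp]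
      exact Real.exp_le_exp.2 ((le_abs_self _).trans (hF1 w)))
  calc ∫ w, Real.exp (F w) ∂P
      ≤ ∫ w, (1 + F w + 0.7223 * F w ^ 2) ∂P :=
        integral_mono hie (((integrable_const 1).add hi).add (hi2.const_mul _))
          fun w => exp_le_one_add_add_sq (hF1 w)
    _ = 1 + ∫ w, F w ∂P + 0.7223 * ∫ w, F w ^ 2 ∂P := by
        have h1 : Integrable (fun w => 1 + F w) P := (integrable_const 1).add hi
        rw [integral_add h1 (hi2.const_mul _), integral_add (integrable_const 1) hi,
          integral_const_mul]
        simp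
    _ ≤ (∫ w, F w ∂P + 0.7223 * c) + 1 := by linarith
    _ ≤ _ := Real.add_one_le_exp _

/-- The witness is the infimum of the points where the distribution function reaches `p`: right
continuity gives one inequality, the left limit the other. The law may have an atom there, hence two
inequalities. -/
theorem exists_quantile [IsProbabilityMeasure P] {W : E → ℝ} (hW : Measurable W) {p : ℝ}
    (hp0 : 0 < p) (hp1 : p < 1) :
    ∃ A : ℝ, P.real {w | W w < A} ≤ p ∧ p ≤ P.real {w | W w ≤ A} := by
  have : IsProbabilityMeasure (P.map W) := Measure.isProbabilityMeasure_map hW.aemeasurable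
  set F := cdf (P.map W) with hF
  have hFle : ∀ x, F x = P.real {w | W w ≤ x} := fun x => by
    rw [hF, cdf_eq_real, map_measureReal_apply hW measurableSet_Iic]
    rfl
  have hFlt : ∀ x, P.real {w | W w < x} = Function.leftLim F x := fun x => by
    have h1 : (P.map W) (Set.Iio x) = ENNReal.ofReal (Function.leftLim F x - 0) := by
      conv_lhs => rw [← measure_cdf (P.map W)]
      exact StieltjesFunction.measure_Iio _ (tendsto_cdf_atBot _) x
    rw [Measure.map_apply hW measurableSet_Iio, sub_zero] at h1
    have h0 : 0 ≤ Function.leftLim F x :=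
      (cdf_nonneg _ (x - 1)).trans ((monotone_cdf _).le_leftLim (by linarith))
    rw [measureReal_def, ← ENNReal.toReal_ofReal h0, ← h1]
    rfl
  set T := {x | p ≤ F x} with hT
  have hne : T.Nonempty :=
    ((tendsto_cdf_atTop (P.map W)).eventually_const_le hp1).exists
  have hbdd : BddBelow T := by
    obtain ⟨b, hb⟩ := ((tendsto_cdf_atBot (P.map W)).eventually_lt_const hp0).exists
    refine ⟨b, fun x hx => ?_⟩
    by_contra! hlt
    exact absurd (hx.trans (monotone_cdf _ hlt.le)) (not_le.2 hb)
  refine ⟨sInf T, ?_, ?_⟩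
  · rw [hFlt]
    refine le_of_tendsto ((monotone_cdf _).tendsto_leftLim _)
      (Filter.eventually_of_mem self_mem_nhdsWithin fun x hx => ?_)
    by_contra! hlt
    exact absurd (csInf_le hbdd (show x ∈ T from hlt.le)) (not_le.2 hx)
  · rw [← hFle]
    have hcont : Filter.Tendsto F (nhdsWithin (sInf T) (Set.Ioi (sInf T))) (nhds (F (sInf T))) :=
      (F.right_continuous _).tendsto.mono_left (nhdsWithin_mono _ Set.Ioi_subset_Ici_self)
    refine ge_of_tendsto hcont (Filter.eventually_of_mem self_mem_nhdsWithin fun x hx => ?_)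
    obtain ⟨y, hy, hyx⟩ := exists_lt_of_csInf_lt hne hx
    exact hy.trans (monotone_cdf _ hyx.le)

end Tail

/-! ### Truncation of heavy-tailed variables -/

/-- The level `m p^{α/(1+α)} / p` which `|U|` exceeds with probability at most `p` when
`E|U|^{1+α} ≤ m^{1+α}`. -/
noncomputable def tailLevel (m α p : ℝ) : ℝ := m * p ^ (α / (1 + α)) / p

theorem tailLevel_pos {m α p : ℝ} (hm : 0 < m) (hp : 0 < p) : 0 < tailLevel m α p := by
  unfold tailLevel
  positivity

theorem mul_tailLevel {m α p : ℝ} (hp : 0 < p) :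
    p * tailLevel m α p = m * p ^ (α / (1 + α)) := by
  unfold tailLevel
  field_simp

/-- This identity is the calibration of the level: it is the equality case of Markov's inequality
for the power `1 + α`. -/
theorem mul_tailLevel_rpow {m α p : ℝ} (hm : 0 < m) (hα : 0 < α) (hp : 0 < p) :
    p * tailLevel m α p ^ (1 + α) = m ^ (1 + α) := by
  unfold tailLevel
  rw [Real.div_rpow (by positivity) hp.le, Real.mul_rpow hm.le (by positivity), ← Real.rpow_mul hp.le,
    div_mul_cancel₀ _ (by positivity), add_comm 1 α, Real.rpow_add_one hp.ne']
  field_simp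

theorem tailLevel_anti {m α p p' : ℝ} (hm : 0 < m) (hα : 0 < α) (hp : 0 < p) (h : p ≤ p') :
    tailLevel m α p' ≤ tailLevel m α p := by
  have hp' := hp.trans_le h
  have h1 := mul_tailLevel_rpow hm hα hp
  have h2 := mul_tailLevel_rpow hm hα hp'
  by_contra! hlt
  have h3 := Real.rpow_lt_rpow (tailLevel_pos hm hp).le hlt (by linarith : 0 < 1 + α)
  have h4 : 0 < tailLevel m α p ^ (1 + α) := Real.rpow_pos_of_pos (tailLevel_pos hm hp) _
  nlinarith

section Moments

variable {E : Type*} [MeasurableSpace E] {P : Measure E} {U V : E → ℝ}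
  {m v α : ℝ}

theorem measureReal_tailLevel_lt [IsProbabilityMeasure P] (hm : 0 < m) (hα : 0 < α)
    (hUi : Integrable (fun w => |U w| ^ (1 + α)) P) (hU : ∫ w, |U w| ^ (1 + α) ∂P ≤ m ^ (1 + α))
    {p : ℝ} (hp : 0 < p) : P.real {w | tailLevel m α p < |U w|} ≤ p := by
  have hQ := tailLevel_pos (α := α) hm hp
  have hQ' : 0 < tailLevel m α p ^ (1 + α) := Real.rpow_pos_of_pos hQ _
  have h := mul_meas_ge_le_integral_of_nonneg
    (.of_forall fun w => Real.rpow_nonneg (abs_nonneg (U w)) (1 + α)) hUi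
    (tailLevel m α p ^ (1 + α))
  have hsub : {w | tailLevel m α p < |U w|} ⊆
      {w | tailLevel m α p ^ (1 + α) ≤ |U w| ^ (1 + α)} := fun w hw =>
    Real.rpow_le_rpow hQ.le (le_of_lt hw) (by linarith)
  have h1 := measureReal_mono (μ := P) hsub
  have h2 := mul_tailLevel_rpow hm hα hp
  have h3 : tailLevel m α p ^ (1 + α) * P.real {w | tailLevel m α p < |U w|} ≤
      tailLevel m α p ^ (1 + α) * p := by
    calc _ ≤ _ := mul_le_mul_of_nonneg_left h1 hQ'.le
      _ ≤ _ := h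
      _ ≤ _ := by linarith
  exact le_of_mul_le_mul_left h3 hQ'

theorem measureReal_div_lt [IsProbabilityMeasure P] (hv : 0 < v) (hV0 : ∀ w, 0 ≤ V w) (hVi : Integrable V P)
    (hV : ∫ w, V w ∂P ≤ v) {p : ℝ} (hp : 0 < p) : P.real {w | v / p < V w} ≤ p := by
  have hQ : 0 < v / p := by positivity
  have h := mul_meas_ge_le_integral_of_nonneg (.of_forall hV0) hVi (v / p)
  have hsub : {w | v / p < V w} ⊆ {w | v / p ≤ V w} := fun w hw =>
    le_of_lt (show v / p < V w from hw)
  have h1 := measureReal_mono (μ := P) hsub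
  have h3 : v / p * P.real {w | v / p < V w} ≤ v / p * p := by
    calc _ ≤ _ := mul_le_mul_of_nonneg_left h1 hQ.le
      _ ≤ _ := h
      _ ≤ _ := hV
      _ = _ := by field_simp
  exact le_of_mul_le_mul_left h3 hQ

theorem measureReal_add_lt [IsProbabilityMeasure P] (hm : 0 < m) (hα : 0 < α)
    (hUi : Integrable (fun w => |U w| ^ (1 + α)) P) (hU : ∫ w, |U w| ^ (1 + α) ∂P ≤ m ^ (1 + α))
    (hv : 0 < v) (hV0 : ∀ w, 0 ≤ V w) (hVi : Integrable V P) (hV : ∫ w, V w ∂P ≤ v)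
    {p p' : ℝ} (hp : 0 < p) (hp' : 0 < p') :
    P.real {w | tailLevel m α p + v / p' < |U w| + V w} ≤ p + p' := by
  have hsub : {w | tailLevel m α p + v / p' < |U w| + V w} ⊆
      {w | tailLevel m α p < |U w|} ∪ {w | v / p' < V w} := by
    intro w hw
    by_contra! hcon
    rw [Set.mem_union, not_or] at hcon
    have h1 : |U w| ≤ tailLevel m α p := not_lt.1 hcon.1
    have h2 : V w ≤ v / p' := not_lt.1 hcon.2
    exact absurd (show tailLevel m α p + v / p' < |U w| + V w from hw) (by linarith)
  exact (measureReal_mono hsub).trans ((measureReal_union_le _ _).trans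
    (add_le_add (measureReal_tailLevel_lt hm hα hUi hU hp) (measureReal_div_lt hv hV0 hVi hV hp')))

/-- The mean excess of `|U|` over its tail level. -/
theorem integral_excess_le (hm : 0 < m) (hα : 0 < α) (hUm : Measurable U)
    (hUi : Integrable (fun w => |U w| ^ (1 + α)) P) (hU : ∫ w, |U w| ^ (1 + α) ∂P ≤ m ^ (1 + α))
    {p : ℝ} (hp : 0 < p) :
    Integrable (fun w => max (|U w| - tailLevel m α p) 0) P ∧
      ∫ w, max (|U w| - tailLevel m α p) 0 ∂P ≤ m * p ^ (α / (1 + α)) := by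
  set Q := tailLevel m α p with hQdef
  have hQ : 0 < Q := tailLevel_pos hm hp
  have hQα : 0 < Q ^ α := Real.rpow_pos_of_pos hQ _
  -- Where `|U| ≥ Q`, one has `1 ≤ (|U| / Q) ^ α`.
  have hle : ∀ w, max (|U w| - Q) 0 ≤ (Q ^ α)⁻¹ * |U w| ^ (1 + α) := by
    intro w
    rcases le_total (|U w|) Q with h | h
    · rw [max_eq_right (by linarith)]
      positivity
    · have hUpos : 0 < |U w| := hQ.trans_le h
      rw [max_eq_left (by linarith), add_comm 1 α, Real.rpow_add_one hUpos.ne',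
        inv_mul_eq_div, le_div_iff₀ hQα]
      have := Real.rpow_le_rpow hQ.le h hα.le
      calc (|U w| - Q) * Q ^ α ≤ |U w| * |U w| ^ α := by gcongr; linarith
        _ = _ := mul_comm _ _
  have hi : Integrable (fun w => max (|U w| - Q) 0) P := by
    refine (hUi.const_mul (Q ^ α)⁻¹).mono' ?_ (.of_forall fun w => ?_)
    · exact ((hUm.norm.sub_const Q).max measurable_const).aestronglyMeasurable
    · rw [Real.norm_eq_abs, abs_of_nonneg (le_max_right _ _)]
      exact hle w
  refine ⟨hi, ?_⟩
  calc ∫ w, max (|U w| - Q) 0 ∂P ≤ ∫ w, (Q ^ α)⁻¹ * |U w| ^ (1 + α) ∂P :=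
        integral_mono hi (hUi.const_mul _) hle
    _ ≤ (Q ^ α)⁻¹ * m ^ (1 + α) := by
        rw [integral_const_mul]
        gcongr
    _ = m * p ^ (α / (1 + α)) := by
        rw [← mul_tailLevel_rpow hm hα hp, ← mul_tailLevel hp, ← hQdef, add_comm 1 α,
          Real.rpow_add_one hQ.ne']
        field_simp

/-- The second moment of `|U| + V` truncated at the sum of the tail levels of `U` and `V`. -/
theorem integral_sq_min_le (hm : 0 < m) (hα : 0 < α) (hα1 : α ≤ 1) (hUm : Measurable U)
    (hVm : Measurable V)
    (hUi : Integrable (fun w => |U w| ^ (1 + α)) P) (hU : ∫ w, |U w| ^ (1 + α) ∂P ≤ m ^ (1 + α))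
    (hv : 0 < v) (hV0 : ∀ w, 0 ≤ V w) (hVi : Integrable V P) (hV : ∫ w, V w ∂P ≤ v)
    {p p' : ℝ} (hp : 0 < p) (hp' : 0 < p') {B : ℝ} (hB : B = tailLevel m α p + v / p') :
    ∫ w, (min (|U w| + V w) B / B) ^ 2 ∂P ≤ 2 * (p + p') := by
  set Q := tailLevel m α p with hQdef
  have hQ : 0 < Q := tailLevel_pos hm hp
  have hvp : 0 < v / p' := by positivity
  have hQB : Q ≤ B := by linarith
  have hVB : v / p' ≤ B := by linarith
  have hB0 : 0 < B := by linarith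
  have hQ1 : 0 < Q ^ (1 + α) := Real.rpow_pos_of_pos hQ _
  -- Split into truncations `a` of `|U| / B` and `b` of `V / B`, both in `[0, 1]`. Then `a² ≤
  -- a^(1+α)` and `b² ≤ b`, so a moment of order `1 + α` of `U` and a first moment of `V` suffice;
  -- their normalised means are at most `p` and `p'`.
  have hle : ∀ w, (min (|U w| + V w) B / B) ^ 2 ≤
      2 * ((Q ^ (1 + α))⁻¹ * |U w| ^ (1 + α) + (v / p')⁻¹ * V w) := by
    intro w
    have hU0 := abs_nonneg (U w)
    set a := min (|U w|) B / B
    set b := min (V w) B / B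
    have ha0 : 0 ≤ a := by positivity
    have hb0 : 0 ≤ b := div_nonneg (le_min (hV0 w) hB0.le) hB0.le
    have ha1 : a ≤ 1 := (div_le_one hB0).2 (min_le_right _ _)
    have hb1 : b ≤ 1 := (div_le_one hB0).2 (min_le_right _ _)
    have hab : min (|U w| + V w) B / B ≤ a + b := by
      rw [← add_div]
      gcongr
      have := hV0 w
      rcases le_total (|U w|) B with h1 | h1 <;> rcases le_total (V w) B with h2 | h2 <;>
        simp only [min_eq_left h1, min_eq_right h1, min_eq_left h2, min_eq_right h2]
      · exact min_le_left _ _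
      · exact (min_le_right _ _).trans (by linarith)
      · exact (min_le_right _ _).trans (by linarith)
      · exact (min_le_right _ _).trans (by linarith)
    have hnn : 0 ≤ min (|U w| + V w) B / B :=
      div_nonneg (le_min (add_nonneg hU0 (hV0 w)) hB0.le) hB0.le
    have hsqa : a ^ 2 ≤ (Q ^ (1 + α))⁻¹ * |U w| ^ (1 + α) := by
      have h1 : a ^ 2 ≤ a ^ (1 + α) := by
        rw [← Real.rpow_two]
        rcases ha0.eq_or_lt with h | h
        · rw [← h, Real.zero_rpow (by norm_num), Real.zero_rpow (by linarith)]
        · exact Real.rpow_le_rpow_of_exponent_ge h ha1 (by linarith)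
      have h2 : a ≤ |U w| / Q := by
        exact div_le_div₀ hU0 (min_le_left _ _) hQ hQB
      calc a ^ 2 ≤ a ^ (1 + α) := h1
        _ ≤ (|U w| / Q) ^ (1 + α) := Real.rpow_le_rpow ha0 h2 (by linarith)
        _ = _ := by rw [Real.div_rpow hU0 hQ.le, inv_mul_eq_div]
    have hsqb : b ^ 2 ≤ (v / p')⁻¹ * V w := by
      have h2 : b ≤ V w / (v / p') := div_le_div₀ (hV0 w) (min_le_left _ _) hvp hVB
      rw [inv_mul_eq_div]
      nlinarith
    calc _ ≤ (a + b) ^ 2 := by gcongr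
      _ ≤ 2 * (a ^ 2 + b ^ 2) := by nlinarith [sq_nonneg (a - b)]
      _ ≤ _ := by linarith
  have hi1 := hUi.const_mul (Q ^ (1 + α))⁻¹
  have hi2 := hVi.const_mul (v / p')⁻¹
  have hi : Integrable (fun w => (min (|U w| + V w) B / B) ^ 2) P := by
    refine ((hi1.add hi2).const_mul 2).mono' ?_ (.of_forall fun w => ?_)
    · exact ((((hUm.norm.add hVm).min measurable_const).div_const B).pow_const 2).aestronglyMeasurable
    · rw [Real.norm_eq_abs, abs_of_nonneg (sq_nonneg _)]
      exact hle w
  refine (integral_mono hi ((hi1.add hi2).const_mul 2) hle).trans ?_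
  simp only [Pi.add_apply]
  rw [integral_const_mul, integral_add hi1 hi2, integral_const_mul, integral_const_mul]
  have e1 : (Q ^ (1 + α))⁻¹ * ∫ w, |U w| ^ (1 + α) ∂P ≤ p := by
    rw [inv_mul_le_iff₀ hQ1, mul_comm, mul_tailLevel_rpow hm hα hp]
    exact hU
  have e2 : (v / p')⁻¹ * ∫ w, V w ∂P ≤ p' := by
    rw [inv_mul_le_iff₀ hvp, div_mul_cancel₀ _ hp'.ne']
    exact hV
  linarith

end Moments

/-! ### One-sided bound for a trimmed sum -/

section Deterministic

variable {n : ℕ} {I : Finset (Fin n)}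

/-- A sum clipped between levels `a` and `b`, controlled through counts in the first half of the
sample, is at most the sum over the indices in `I` clipped between fixed levels `A` and `B`, up to
the contribution of the indices outside `I`. -/
theorem sum_clamp_le_sum_clamp {W y : Fin n → ℝ} {A B a b K K' : ℝ} (hB0 : 0 ≤ B) (hAB : A ≤ B)
    (hy : ∀ i ∈ I, y i ≤ W i)
    (hb : ∀ t, t < b → K ≤ (Finset.univ.filter fun i : Fin n => i.val < n / 2 ∧ t < y i).card)
    (ha : ∀ t, t < a → (Finset.univ.filter fun i : Fin n => i.val < n / 2 ∧ y i ≤ t).card ≤ K')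
    (h1 : (((I.filter fun i => i.val < n / 2).filter fun i => B < W i).card : ℝ) + Iᶜ.card < K)
    (h2 : K' < ((I.filter fun i => i.val < n / 2).filter fun i => W i ≤ A).card) :
    ∑ i : Fin n with n / 2 ≤ i.val, max a (min (y i) b) ≤
      ∑ i ∈ I.filter (fun i => n / 2 ≤ i.val), max A (min (W i) B) + Iᶜ.card * B := by
  have hbB : b ≤ B := by
    by_contra! hlt
    have hcard : (Finset.univ.filter fun i : Fin n => i.val < n / 2 ∧ B < y i).card ≤
        ((I.filter fun i => i.val < n / 2).filter fun i => B < W i).card + Iᶜ.card := by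
      refine (Finset.card_le_card fun i hi => ?_).trans (Finset.card_union_le _ _)
      have hi' := (Finset.mem_filter.1 hi).2
      by_cases hI : i ∈ I
      · exact Finset.mem_union_left _ (Finset.mem_filter.2 ⟨Finset.mem_filter.2 ⟨hI, hi'.1⟩,
          hi'.2.trans_le (hy i hI)⟩)
      · exact Finset.mem_union_right _ (Finset.mem_compl.2 hI)
    have hcard' : ((Finset.univ.filter fun i : Fin n => i.val < n / 2 ∧ B < y i).card : ℝ) ≤
        ((I.filter fun i => i.val < n / 2).filter fun i => B < W i).card + Iᶜ.card := by
      exact_mod_cast hcard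
    linarith [hb B hlt]
  have haA : a ≤ A := by
    by_contra! hlt
    have hcard : ((I.filter fun i => i.val < n / 2).filter fun i => W i ≤ A).card ≤
        (Finset.univ.filter fun i : Fin n => i.val < n / 2 ∧ y i ≤ A).card := by
      refine Finset.card_le_card fun i hi => ?_
      have hi' := Finset.mem_filter.1 hi
      have hi'' := Finset.mem_filter.1 hi'.1
      exact Finset.mem_filter.2 ⟨Finset.mem_univ _, hi''.2, (hy i hi''.1).trans hi'.2⟩
    have hcard' : (((I.filter fun i => i.val < n / 2).filter fun i => W i ≤ A).card : ℝ) ≤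
        (Finset.univ.filter fun i : Fin n => i.val < n / 2 ∧ y i ≤ A).card := by
      exact_mod_cast hcard
    linarith [ha A hlt]
  rw [← Finset.sum_filter_add_sum_filter_not _ (· ∈ I)]
  refine add_le_add ?_ ?_
  · have hset : (Finset.univ.filter fun i : Fin n => n / 2 ≤ i.val).filter (· ∈ I) =
        I.filter fun i => n / 2 ≤ i.val := by
      ext i
      simp [and_comm]
    rw [hset]
    refine Finset.sum_le_sum fun i hi => ?_
    exact max_le_max haA (min_le_min (hy i (Finset.mem_filter.1 hi).1) hbB)
  · refine (Finset.sum_le_card_nsmul _ _ B fun i _ => ?_).trans ?_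
    · exact max_le (haA.trans hAB) ((min_le_right _ _).trans hbB)
    · rw [nsmul_eq_mul]
      gcongr
      intro i hi
      exact Finset.mem_compl.2 (Finset.mem_filter.1 hi).2

theorem card_firstHalf (hn : Even n) :
    ((Finset.univ.filter fun i : Fin n => i.val < n / 2).card : ℝ) = n / 2 := by
  have h := card_filter_firstHalf (n := n) (fun _ => 0) (fun _ => True)
  simp only [and_true, Finset.filter_true, Finset.card_univ, Fintype.card_fin] at h
  rw [← h]
  obtain ⟨k, rfl⟩ := hn
  rw [← two_mul, Nat.mul_div_cancel_left k two_pos]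
  push_cast
  ring

theorem card_secondHalf (hn : Even n) :
    ((Finset.univ.filter fun i : Fin n => n / 2 ≤ i.val).card : ℝ) = n / 2 := by
  have h := Finset.card_filter_add_card_filter_not (s := (Finset.univ : Finset (Fin n)))
    (fun i : Fin n => i.val < n / 2)
  simp only [not_lt, Finset.card_univ, Fintype.card_fin] at h
  have h' : ((Finset.univ.filter fun i : Fin n => i.val < n / 2).card : ℝ) +
      (Finset.univ.filter fun i : Fin n => n / 2 ≤ i.val).card = n := by exact_mod_cast h
  rw [card_firstHalf hn] at h'
  linarith

theorem card_filter_firstHalf_le (hn : Even n) :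
    ((I.filter fun i => i.val < n / 2).card : ℝ) ≤ n / 2 := by
  rw [← card_firstHalf hn]
  exact_mod_cast Finset.card_le_card (Finset.filter_subset_filter _ (Finset.subset_univ I))

theorem card_filter_secondHalf_le (hn : Even n) :
    ((I.filter fun i => n / 2 ≤ i.val).card : ℝ) ≤ n / 2 := by
  rw [← card_secondHalf hn]
  exact_mod_cast Finset.card_le_card (Finset.filter_subset_filter _ (Finset.subset_univ I))

theorem le_card_filter_firstHalf (hn : Even n) :
    (n / 2 : ℝ) ≤ (I.filter fun i => i.val < n / 2).card + Iᶜ.card := by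
  rw [← card_firstHalf hn]
  have : (Finset.univ.filter fun i : Fin n => i.val < n / 2).card ≤
      (I.filter fun i => i.val < n / 2).card + Iᶜ.card := by
    refine (Finset.card_le_card fun i hi => ?_).trans (Finset.card_union_le _ _)
    by_cases hI : i ∈ I
    · exact Finset.mem_union_left _ (Finset.mem_filter.2 ⟨hI, (Finset.mem_filter.1 hi).2⟩)
    · exact Finset.mem_union_right _ (Finset.mem_compl.2 hI)
  exact_mod_cast this

/-- The map `w ↦ max A (min w B)` is 1-Lipschitz and takes the value `max A 0` at `0`. Recentring
there, and not at the mean, keeps the second moment small while the bound stays `B`. -/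
theorem abs_clamp_sub_le {A B w : ℝ} (hB : 0 ≤ B) (hAB : A ≤ B) (hBA : -B ≤ A) :
    |max A (min w B) - max A 0| ≤ min |w| B := by
  refine le_min ?_ ?_
  · calc |max A (min w B) - max A 0| ≤ |min w B - 0| := by
          have := abs_max_sub_max_le_max A (min w B) A 0
          simpa using this
      _ ≤ |w| := by
          have := abs_min_sub_min_le_max w B 0 B
          simpa [min_eq_left hB] using this
  · rw [abs_le]
    constructor
    · have h1 : max A 0 ≤ max A (min w B) + B := by
        refine max_le ?_ ?_
        · linarith [le_max_left A (min w B)]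
        · linarith [le_max_left A (min w B)]
      linarith
    · have h1 : max A (min w B) ≤ B := max_le hAB (min_le_right _ _)
      linarith [le_max_right A 0]

end Deterministic

/-! ### Concentration at fixed clipping levels -/

section Core

variable {Ω E : Type*} [MeasurableSpace Ω] [MeasurableSpace E] {μ : Measure Ω} {P : Measure E}
  [IsProbabilityMeasure P] {n : ℕ} {Z : Fin n → Ω → E} {I : Finset (Fin n)}

theorem exp_two_sub_one_le : Real.exp 2 - 1 ≤ 6.3891 := by
  have h := Real.exp_one_lt_d9
  have : Real.exp 2 = Real.exp 1 ^ 2 := by rw [← Real.exp_nat_mul]; norm_num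
  rw [this]
  have h0 := Real.exp_pos 1
  nlinarith

theorem exp_neg_one_sub_one_le : Real.exp (-1) - 1 ≤ -0.632 := by
  have h := Real.exp_one_gt_d9
  rw [Real.exp_neg]
  have h1 : (Real.exp 1)⁻¹ ≤ (2.7182818283)⁻¹ := inv_anti₀ (by norm_num) h.le
  have h2 : (2.7182818283 : ℝ)⁻¹ ≤ 0.368 := by norm_num
  linarith

/-- Three bad events, each of probability at most `exp(-5u)`, are excluded: too many inliers above
`B`, too few below `A`, and a large deviation of the clipped inlier sum. On the complement the
deterministic comparison applies to every admissible `y`, `a`, `b`. -/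
theorem exists_event_sum_clamp_le_of_levels
    (hmeas : ∀ i ∈ I, Measurable (Z i)) (hlaw : ∀ i ∈ I, μ.map (Z i) = P)
    (hind : iIndepFun (fun i : I => Z i) μ) (hn : Even n) {η u ε : ℝ} (hη : 0 ≤ η)
    (hout : (Iᶜ.card : ℝ) ≤ η * n) (hu : 2.38 ≤ u) (hε : ε * (n / 2) = 4 * η * n + 6 * u)
    {U V : E → ℝ} (hUm : Measurable U) (hVm : Measurable V) (hV0 : ∀ w, 0 ≤ V w) {A B e : ℝ}
    (hB0 : 0 < B) (hAB : A ≤ B) (hBA : -B ≤ A)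
    (hp : P.real {w | B < |U w| + V w} ≤ 0.16 * ε)
    (hsq : ∫ w, (min (|U w| + V w) B / B) ^ 2 ∂P ≤ 0.32 * ε) (he0 : 0 ≤ e)
    (he : ∫ w, max A (min (U w + V w) B) ∂P ≤ e)
    (hA : μ {ω | (((I.filter fun i => i.val < n / 2).filter
        fun i => U (Z i ω) + V (Z i ω) ≤ A).card : ℝ) ≤ ε * (n / 2) + 1} ≤
      ENNReal.ofReal (Real.exp (-(5 * u)))) :
    ∃ G : Set Ω, MeasurableSet G ∧ μ Gᶜ ≤ 3 * ENNReal.ofReal (Real.exp (-(5 * u))) ∧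
      ∀ ω ∈ G, ∀ (y : Fin n → ℝ) (a b : ℝ), (∀ i ∈ I, y i ≤ U (Z i ω) + V (Z i ω)) →
      (∀ t, t < b → ε * (n / 2) - 1 ≤
        (Finset.univ.filter fun i : Fin n => i.val < n / 2 ∧ t < y i).card) →
      (∀ t, t < a → (Finset.univ.filter fun i : Fin n => i.val < n / 2 ∧ y i ≤ t).card ≤
        ε * (n / 2) + 1) →
      ∑ i : Fin n with n / 2 ≤ i.val, max a (min (y i) b) ≤
        n / 2 * (e + 1.06454 * ε * B) := by
  classical
  set S₁ := I.filter fun i => i.val < n / 2 with hS₁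
  set S₂ := I.filter fun i => n / 2 ≤ i.val with hS₂
  have hS₁I : S₁ ⊆ I := Finset.filter_subset _ _
  have hS₂I : S₂ ⊆ I := Finset.filter_subset _ _
  have hS₁n : (S₁.card : ℝ) ≤ n / 2 := card_filter_firstHalf_le hn
  have hS₂n : (S₂.card : ℝ) ≤ n / 2 := card_filter_secondHalf_le hn
  have hn0 : (0 : ℝ) ≤ n := n.cast_nonneg
  have hηn : 0 ≤ η * n := by positivity
  have hn0' : (0 : ℝ) < n := by
    rcases hn0.eq_or_lt with h | h
    · rw [← h] at hε
      linarith
    · exact h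
  have hε0 : 0 < ε := by
    by_contra! hle
    nlinarith
  have hWm : Measurable fun w => U w + V w := hUm.add hVm
  let c₀ := max A 0
  let F : E → ℝ := fun w => (max A (min (U w + V w) B) - c₀) / B
  have hFm : Measurable F :=
    ((measurable_const.max (hWm.min measurable_const)).sub_const _).div_const _
  have habs : ∀ w, |F w| ≤ min (|U w| + V w) B / B := by
    intro w
    rw [abs_div, abs_of_pos hB0]
    gcongr
    refine (abs_clamp_sub_le hB0.le hAB hBA).trans (min_le_min ?_ le_rfl)
    exact (abs_add_le _ _).trans (by rw [abs_of_nonneg (hV0 w)])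
  have hF1 : ∀ w, |F w| ≤ 1 := fun w =>
    (habs w).trans ((div_le_one hB0).2 (min_le_right _ _))
  have hF2 : ∫ w, F w ^ 2 ∂P ≤ 0.32 * ε := by
    refine (integral_mono_of_nonneg (.of_forall fun w => sq_nonneg _) ?_
      (.of_forall fun w => ?_)).trans hsq
    · refine .of_bound (((hUm.norm.add hVm).min measurable_const).div_const B
        |>.pow_const 2).aestronglyMeasurable 1 (.of_forall fun w => ?_)
      have h0 : 0 ≤ min (|U w| + V w) B / B := (abs_nonneg _).trans (habs w)
      have h1 : min (|U w| + V w) B / B ≤ 1 := (div_le_one hB0).2 (min_le_right _ _)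
      rw [Real.norm_eq_abs, abs_of_nonneg (sq_nonneg _)]
      exact pow_le_one₀ h0 h1
    · exact sq_le_sq' (by linarith [neg_abs_le (F w), habs w]) ((le_abs_self _).trans (habs w))
  have hκ := integral_exp_le_of_sq_le hFm hF1 hF2
  have hclampi : Integrable (fun w => max A (min (U w + V w) B)) P := by
    refine .of_bound (measurable_const.max (hWm.min measurable_const)).aestronglyMeasurable
      B (.of_forall fun w => ?_)
    rw [Real.norm_eq_abs, abs_le]
    exact ⟨hBA.trans (le_max_left _ _), max_le hAB (min_le_right _ _)⟩
  have hFint : B * ∫ w, F w ∂P = ∫ w, max A (min (U w + V w) B) ∂P - c₀ := by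
    rw [integral_div, integral_sub hclampi (integrable_const _)]
    simp only [integral_const, probReal_univ, one_smul]
    field_simp
  set f := ∫ w, F w ∂P with hf
  let s : Set E := {w | B < U w + V w}
  have hs : MeasurableSet s := measurableSet_lt measurable_const hWm
  have hsp : P.real s ≤ 0.16 * ε := by
    refine (measureReal_mono fun w hw => ?_).trans hp
    exact (show B < U w + V w from hw).trans_le (by linarith [le_abs_self (U w)])
  -- The factor `2` is the Chernoff parameter. The threshold is the number of values above the upper
  -- level, less the outliers.
  let c₁ := 2 * (ε * (n / 2) - 1 - Iᶜ.card)
  let c₃ := S₂.card * f + 0.2312 * ε * (n / 2) + 5 * u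
  let D₁ : Set Ω := {ω | c₁ ≤ 2 * (S₁.filter fun i => Z i ω ∈ s).card}
  let D₂ : Set Ω := {ω | ((S₁.filter fun i => U (Z i ω) + V (Z i ω) ≤ A).card : ℝ) ≤
    ε * (n / 2) + 1}
  let D₃ : Set Ω := {ω | c₃ ≤ ∑ i ∈ S₂, F (Z i ω)}
  have hcount : ∀ t : Set E, MeasurableSet t →
      Measurable fun ω => ((S₁.filter fun i => Z i ω ∈ t).card : ℝ) := by
    intro t ht
    have : (fun ω => ((S₁.filter fun i => Z i ω ∈ t).card : ℝ)) =
        fun ω => ∑ i ∈ S₁, if Z i ω ∈ t then (1 : ℝ) else 0 := by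
      ext ω
      simp
    rw [this]
    exact Finset.measurable_sum _ fun i hi =>
      Measurable.ite (hmeas i (hS₁I hi) ht) measurable_const measurable_const
  have hD₁ : MeasurableSet D₁ := measurableSet_le measurable_const ((hcount s hs).const_mul 2)
  have hD₂ : MeasurableSet D₂ :=
    measurableSet_le (hcount {w | U w + V w ≤ A} (measurableSet_le hWm measurable_const))
      measurable_const
  have hD₃ : MeasurableSet D₃ := measurableSet_le measurable_const
    (Finset.measurable_sum _ fun i hi => hFm.comp (hmeas i (hS₂I hi)))
  have hμ₁ : μ D₁ ≤ ENNReal.ofReal (Real.exp (-(5 * u))) := by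
    -- Here `1.022256 = 6.3891 * 0.16`. The exponent is then at most `-5u` because `2 ≤ 0.866u`,
    -- which is where `u ≥ 2.38` is needed.
    refine (measure_count_ge_le hmeas hlaw hind hS₁I hs (t := 2) (κ := 1.022256 * ε) ?_ c₁).trans ?_
    · have h1 := exp_two_sub_one_le
      have h2 := Real.add_one_le_exp (1.022256 * ε)
      have h3 : (Real.exp 2 - 1) * P.real s ≤ 6.3891 * (0.16 * ε) :=
        mul_le_mul h1 hsp measureReal_nonneg (by norm_num)
      linarith
    · refine ENNReal.ofReal_le_ofReal (Real.exp_le_exp.2 ?_)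
      have h1 : (S₁.card : ℝ) * (1.022256 * ε) ≤ n / 2 * (1.022256 * ε) := by gcongr
      simp only [c₁]
      nlinarith
  have hμ₃ : μ D₃ ≤ ENNReal.ofReal (Real.exp (-(5 * u))) := by
    refine (measure_sum_ge_le hmeas hlaw hind hS₂I hFm (C := 1)
      (fun w => (le_abs_self _).trans (hF1 w)) hκ c₃).trans ?_
    refine ENNReal.ofReal_le_ofReal (Real.exp_le_exp.2 ?_)
    have h1 : (S₂.card : ℝ) * (0.2312 * ε) ≤ n / 2 * (0.2312 * ε) := by gcongr
    have h2 : (S₂.card : ℝ) * (0.7223 * (0.32 * ε)) ≤ S₂.card * (0.2312 * ε) := by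
      refine mul_le_mul_of_nonneg_left ?_ (Nat.cast_nonneg _)
      linarith
    simp only [c₃]
    linarith
  refine ⟨(D₁ ∪ D₂ ∪ D₃)ᶜ, ((hD₁.union hD₂).union hD₃).compl, ?_, ?_⟩
  · rw [compl_compl]
    calc μ (D₁ ∪ D₂ ∪ D₃) ≤ μ D₁ + μ D₂ + μ D₃ :=
          (measure_union_le _ _).trans (by gcongr; exact measure_union_le _ _)
      _ ≤ ENNReal.ofReal (Real.exp (-(5 * u))) + ENNReal.ofReal (Real.exp (-(5 * u))) +
          ENNReal.ofReal (Real.exp (-(5 * u))) := by gcongr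
      _ = _ := by ring
  · intro ω hω y a b hy hb ha
    rw [Set.mem_compl_iff, Set.mem_union, Set.mem_union, not_or, not_or] at hω
    obtain ⟨⟨h₁, h₂⟩, h₃⟩ := hω
    have h₁' : 2 * ((S₁.filter fun i => Z i ω ∈ s).card : ℝ) < c₁ := not_le.1 h₁
    have h₂' : ε * (n / 2) + 1 <
        ((S₁.filter fun i => U (Z i ω) + V (Z i ω) ≤ A).card : ℝ) := not_le.1 h₂
    have h₃' : ∑ i ∈ S₂, F (Z i ω) < c₃ := not_le.1 h₃
    have hdet := sum_clamp_le_sum_clamp (W := fun i => U (Z i ω) + V (Z i ω)) hB0.le hAB hy hb ha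
      (by
        have h4 : ((S₁.filter fun i => B < U (Z i ω) + V (Z i ω)).card : ℝ) =
          (S₁.filter fun i => Z i ω ∈ s).card := rfl
        rw [h4]
        simp only [c₁] at h₁'
        linarith) h₂'
    refine hdet.trans ?_
    have hsum : ∑ i ∈ S₂, max A (min (U (Z i ω) + V (Z i ω)) B) =
        S₂.card * c₀ + B * ∑ i ∈ S₂, F (Z i ω) := by
      rw [Finset.mul_sum, ← nsmul_eq_mul, ← Finset.sum_const, ← Finset.sum_add_distrib]
      refine Finset.sum_congr rfl fun i _ => ?_
      simp only [F]
      field_simp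
      ring
    rw [hsum]
    have h5 : B * ∑ i ∈ S₂, F (Z i ω) ≤ B * c₃ := by gcongr
    have h6 : B * c₃ = S₂.card * (B * f) + B * (0.2312 * ε * (n / 2) + 5 * u) := by
      simp only [c₃]
      ring
    rw [hFint] at h6
    have h7 : (S₂.card : ℝ) * ∫ w, max A (min (U w + V w) B) ∂P ≤ n / 2 * e :=
      (mul_le_mul_of_nonneg_left he (Nat.cast_nonneg _)).trans
        (mul_le_mul_of_nonneg_right hS₂n he0)
    have h8 : (Iᶜ.card : ℝ) * B ≤ η * n * B := by gcongr
    have h9 : B * (0.2312 * ε * (n / 2) + 5 * u) + η * n * B ≤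
        n / 2 * (1.06454 * ε * B) := by
      -- Since `ε * (n / 2) = 4ηn + 6u`, the last two terms are at most `5/6` of it, and `0.2312 +
      -- 5/6 < 1.06454`.
      have : 0.2312 * ε * (n / 2) + 5 * u + η * n ≤ n / 2 * (1.06454 * ε) := by linarith
      calc _ = B * (0.2312 * ε * (n / 2) + 5 * u + η * n) := by ring
        _ ≤ B * (n / 2 * (1.06454 * ε)) := by gcongr
        _ = _ := by ring
    linarith

end Core

/-! ### Choice of the clipping levels -/

section Levels

variable {Ω E : Type*} [MeasurableSpace Ω] [MeasurableSpace E] {μ : Measure Ω} {P : Measure E}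
  [IsProbabilityMeasure P] {n : ℕ} {Z : Fin n → Ω → E} {I : Finset (Fin n)}

/-- Chernoff's bound with parameter `-1`: about `3.2 ε` of the mass lies below `A`, so fewer than
about `ε` of the points there is unlikely. The constant `2.0224` is `0.632 * 3.2`. -/
theorem measure_count_le_of_small
    (hmeas : ∀ i ∈ I, Measurable (Z i)) (hlaw : ∀ i ∈ I, μ.map (Z i) = P)
    (hind : iIndepFun (fun i : I => Z i) μ) (hn : Even n) {η u ε : ℝ} (hη : 0 ≤ η)
    (hout : (Iᶜ.card : ℝ) ≤ η * n) (hu : 2.38 ≤ u) (hε : ε * (n / 2) = 4 * η * n + 6 * u)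
    (hε0 : 0 < ε) (hε1 : ε ≤ 0.2) {W : E → ℝ} (hW : Measurable W) {A : ℝ}
    (hA : 3.2 * ε ≤ P.real {w | W w ≤ A}) :
    μ {ω | (((I.filter fun i => i.val < n / 2).filter fun i => W (Z i ω) ≤ A).card : ℝ) ≤
      ε * (n / 2) + 1} ≤ ENNReal.ofReal (Real.exp (-(5 * u))) := by
  classical
  set S := I.filter fun i => i.val < n / 2 with hS
  have hSn : (n / 2 : ℝ) ≤ S.card + Iᶜ.card := le_card_filter_firstHalf hn
  have hs : MeasurableSet {w | W w ≤ A} := measurableSet_le hW measurable_const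
  have h := measure_count_ge_le hmeas hlaw hind (Finset.filter_subset _ I : S ⊆ I) hs (t := -1)
    (κ := -(2.0224 * ε)) (by
      have h1 := exp_neg_one_sub_one_le
      have h2 := Real.add_one_le_exp (-(2.0224 * ε))
      have h3 : (Real.exp (-1) - 1) * P.real {w | W w ≤ A} ≤ -0.632 * P.real {w | W w ≤ A} :=
        mul_le_mul_of_nonneg_right h1 measureReal_nonneg
      linarith) (-(ε * (n / 2) + 1))
  refine (measure_mono fun ω hω => ?_).trans (h.trans (ENNReal.ofReal_le_ofReal
    (Real.exp_le_exp.2 ?_)))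
  · have hω' : ((S.filter fun i => W (Z i ω) ≤ A).card : ℝ) ≤ ε * (n / 2) + 1 := hω
    show -(ε * (n / 2) + 1) ≤ -1 * ((S.filter fun i => W (Z i ω) ≤ A).card : ℝ)
    linarith
  · have hηn : 0 ≤ η * n := by positivity
    have h1 : 2.0224 * ε * (n / 2 - η * n) ≤ 2.0224 * ε * S.card := by
      gcongr
      linarith
    have h2 : ε * (η * n) ≤ 0.2 * (η * n) := by gcongr
    nlinarith

/-- For larger `ε` a level of mass `3.2 ε` may not exist. Instead `A` is so high that only a tenth
of the mass lies above it, and the points above `A` are counted with Chernoff parameter `2`. -/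
theorem measure_count_le_of_large
    (hmeas : ∀ i ∈ I, Measurable (Z i)) (hlaw : ∀ i ∈ I, μ.map (Z i) = P)
    (hind : iIndepFun (fun i : I => Z i) μ) (hn : Even n) {η u ε : ℝ} (hη : 0 ≤ η)
    (hout : (Iᶜ.card : ℝ) ≤ η * n) (hu : 2.38 ≤ u) (hε : ε * (n / 2) = 4 * η * n + 6 * u)
    (hε1 : ε < 1 / 2) {W : E → ℝ} (hW : Measurable W) {A : ℝ}
    (hA : P.real {w | A < W w} ≤ 0.1) :
    μ {ω | (((I.filter fun i => i.val < n / 2).filter fun i => W (Z i ω) ≤ A).card : ℝ) ≤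
      ε * (n / 2) + 1} ≤ ENNReal.ofReal (Real.exp (-(5 * u))) := by
  classical
  set S := I.filter fun i => i.val < n / 2 with hS
  have hSn : (n / 2 : ℝ) ≤ S.card + Iᶜ.card := le_card_filter_firstHalf hn
  have hs : MeasurableSet {w | A < W w} := measurableSet_lt measurable_const hW
  have h := measure_count_ge_le hmeas hlaw hind (Finset.filter_subset _ I : S ⊆ I) hs (t := 2)
    (κ := 1 / 2) (by
      have h1 := exp_two_sub_one_le
      have h2 := Real.quadratic_le_exp_of_nonneg (x := 1 / 4) (by norm_num)
      have h3 : (Real.exp 2 - 1) * P.real {w | A < W w} ≤ 6.3891 * 0.1 :=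
        mul_le_mul h1 hA measureReal_nonneg (by norm_num)
      have h4 : Real.exp (1 / 2) = Real.exp (1 / 4) * Real.exp (1 / 4) := by
        rw [← Real.exp_add]
        norm_num
      rw [h4]
      nlinarith) (2 * (S.card - ε * (n / 2) - 1))
  refine (measure_mono fun ω hω => ?_).trans (h.trans (ENNReal.ofReal_le_ofReal
    (Real.exp_le_exp.2 ?_)))
  · have hω' : ((S.filter fun i => W (Z i ω) ≤ A).card : ℝ) ≤ ε * (n / 2) + 1 := hω
    have hc := Finset.card_filter_add_card_filter_not (s := S) (fun i => W (Z i ω) ≤ A)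
    simp only [not_le] at hc
    have hc' : ((S.filter fun i => W (Z i ω) ≤ A).card : ℝ) +
      (S.filter fun i => A < W (Z i ω)).card = S.card := by exact_mod_cast hc
    show 2 * (S.card - ε * (n / 2) - 1) ≤ 2 * ((S.filter fun i => A < W (Z i ω)).card : ℝ)
    linarith
  · have hηn : 0 ≤ η * n := by positivity
    have hn0 : (0 : ℝ) ≤ n := n.cast_nonneg
    have h1 : ε * (n / 2) ≤ 1 / 2 * (n / 2) := by gcongr
    linarith

theorem integral_clamp_le_of_quantile {U V : E → ℝ} {m v α : ℝ} (hm : 0 < m) (hα : 0 < α)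
    (hUm : Measurable U) (hVm : Measurable V) (hUint : Integrable U P) (hU0 : ∫ w, U w ∂P = 0)
    (hUi : Integrable (fun w => |U w| ^ (1 + α)) P) (hU : ∫ w, |U w| ^ (1 + α) ∂P ≤ m ^ (1 + α))
    (hV0 : ∀ w, 0 ≤ V w) (hVi : Integrable V P) (hV : ∫ w, V w ∂P ≤ v) {A B p : ℝ} (hp : 0 < p)
    (hAB : A ≤ B) (hBA : -B ≤ A)
    (hA : P.real {w | U w + V w < A} ≤ p) :
    ∫ w, max A (min (U w + V w) B) ∂P ≤ v + max A 0 * p + 2 * (m * p ^ (α / (1 + α))) := by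
  set Q := tailLevel m α p with hQ
  have hQ0 : 0 < Q := tailLevel_pos hm hp
  set s : Set E := {w | U w + V w < A} with hs
  have hsm : MeasurableSet s := measurableSet_lt (hUm.add hVm) measurable_const
  obtain ⟨hei, he⟩ := integral_excess_le hm hα hUm hUi hU hp
  -- Only clipping from below can increase `U + V`. On `{U + V < A}` the increase `A - U - V` is at
  -- most `max A 0 + Q` plus the excess of `|U|` over `Q`, because `V ≥ 0`.
  have hle : ∀ w, max A (min (U w + V w) B) ≤
      U w + V w + ((max A 0 + Q) * s.indicator 1 w + max (|U w| - Q) 0) := by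
    intro w
    have hx := le_max_right (|U w| - Q) 0
    have hx' := le_max_left (|U w| - Q) 0
    by_cases hw : w ∈ s
    · have hlt : U w + V w < A := hw
      rw [Set.indicator_of_mem hw, Pi.one_apply, mul_one]
      refine max_le ?_ ((min_le_left _ _).trans ?_)
      · linarith [le_max_left A 0, neg_abs_le (U w), hV0 w]
      · linarith [le_max_right A 0]
    · have hge : A ≤ U w + V w := not_lt.1 hw
      rw [Set.indicator_of_notMem hw, mul_zero, zero_add]
      exact max_le (by linarith) ((min_le_left _ _).trans (by linarith))
  have hci : Integrable (fun w => max A (min (U w + V w) B)) P := by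
    refine .of_bound (measurable_const.max ((hUm.add hVm).min measurable_const)).aestronglyMeasurable
      B (.of_forall fun w => ?_)
    rw [Real.norm_eq_abs, abs_le]
    exact ⟨hBA.trans (le_max_left _ _), max_le hAB (min_le_right _ _)⟩
  have hii : Integrable (fun w => (max A 0 + Q) * s.indicator (1 : E → ℝ) w) P :=
    ((integrable_const (1 : ℝ)).indicator hsm).const_mul _
  have hUV : Integrable (fun w => U w + V w) P := hUint.add hVi
  have hie : Integrable (fun w => (max A 0 + Q) * s.indicator (1 : E → ℝ) w +
    max (|U w| - Q) 0) P := hii.add hei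
  refine (integral_mono hci (hUV.add hie) hle).trans ?_
  simp only [Pi.add_apply]
  rw [integral_add hUV hie, integral_add hUint hVi, integral_add hii hei, hU0,
    integral_const_mul, integral_indicator_one hsm]
  have h1 : (max A 0 + Q) * P.real s ≤ (max A 0 + Q) * p := by
    have := le_max_right A 0
    gcongr
  have h2 := mul_tailLevel (m := m) (α := α) hp
  rw [← hQ] at h2
  linarith

theorem integral_clamp_le_of_tailLevel {U V : E → ℝ} {m v α : ℝ} (hm : 0 < m) (hα : 0 < α)
    (hUm : Measurable U) (hVm : Measurable V)
    (hUi : Integrable (fun w => |U w| ^ (1 + α)) P) (hU : ∫ w, |U w| ^ (1 + α) ∂P ≤ m ^ (1 + α))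
    (hV0 : ∀ w, 0 ≤ V w) (hVi : Integrable V P) (hV : ∫ w, V w ∂P ≤ v) {A B a p : ℝ} (hp : 0 < p)
    (ha : 0 ≤ a) (hA : A = tailLevel m α p + a) (hAB : A ≤ B) :
    ∫ w, max A (min (U w + V w) B) ∂P ≤ A + m * p ^ (α / (1 + α)) + v := by
  have hQ0 : 0 < tailLevel m α p := tailLevel_pos hm hp
  obtain ⟨hei, he⟩ := integral_excess_le hm hα hUm hUi hU hp
  have hle : ∀ w, max A (min (U w + V w) B) ≤
      A + max (|U w| - tailLevel m α p) 0 + V w := by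
    intro w
    have hx := le_max_right (|U w| - tailLevel m α p) 0
    have hx' := le_max_left (|U w| - tailLevel m α p) 0
    have := hV0 w
    refine max_le (by linarith) ((min_le_left _ _).trans ?_)
    linarith [le_abs_self (U w)]
  have hci : Integrable (fun w => max A (min (U w + V w) B)) P := by
    refine .of_bound (measurable_const.max ((hUm.add hVm).min measurable_const)).aestronglyMeasurable
      B (.of_forall fun w => ?_)
    rw [Real.norm_eq_abs, abs_le]
    exact ⟨by linarith [le_max_left A (min (U w + V w) B)], max_le hAB (min_le_right _ _)⟩
  have h1 : Integrable (fun w => A + max (|U w| - tailLevel m α p) 0) P :=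
    (integrable_const A).add hei
  refine (integral_mono hci (h1.add hVi) hle).trans ?_
  simp only [Pi.add_apply]
  rw [integral_add h1 hVi, integral_add (integrable_const A) hei]
  simp only [integral_const, probReal_univ, one_smul]
  linarith

/-- As `α / (1 + α) ≤ 1/2`, enlarging the probability by `c²` costs at most `c`. This brings all
levels back to `ε / 4`. -/
theorem mul_tailLevel_le {m α p q c : ℝ} (hm : 0 < m) (hα : 0 < α) (hα1 : α ≤ 1) (hp : 0 < p)
    (hc : 1 ≤ c) (hq : 0 < q) (hpq : p ≤ c ^ 2 * q) :
    m * p ^ (α / (1 + α)) ≤ c * (m * q ^ (α / (1 + α))) := by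
  have hβ0 : 0 ≤ α / (1 + α) := by positivity
  have hβ1 : α / (1 + α) ≤ 1 / 2 := by
    rw [div_le_div_iff₀ (by linarith) two_pos]
    linarith
  have h1 : p ^ (α / (1 + α)) ≤ (c ^ 2 * q) ^ (α / (1 + α)) := Real.rpow_le_rpow hp.le hpq hβ0
  rw [Real.mul_rpow (by positivity) hq.le] at h1
  have h2 : (c ^ 2) ^ (α / (1 + α)) ≤ c := by
    calc (c ^ 2) ^ (α / (1 + α)) ≤ (c ^ 2) ^ (1 / 2 : ℝ) :=
          Real.rpow_le_rpow_of_exponent_le (by nlinarith) hβ1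
      _ = c := by rw [← Real.sqrt_eq_rpow, Real.sqrt_sq (by linarith)]
  calc m * p ^ (α / (1 + α)) ≤ m * (c * q ^ (α / (1 + α))) := by
        gcongr
        exact h1.trans (by gcongr)
    _ = _ := by ring

/-- The ratio of the left side to `m (ε/4)^β`, with `β = α / (1 + α)`, is `4 ε^(1-β) ≤ 4√0.2 < 1.8`.
-/
theorem tailLevel_mul_le {m α ε : ℝ} (hm : 0 < m) (hα : 0 < α) (hα1 : α ≤ 1) (hε0 : 0 < ε)
    (hε1 : ε ≤ 0.2) :
    tailLevel m α 0.25 * ε ≤ 1.8 * (m * (ε / 4) ^ (α / (1 + α))) := by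
  have k1 := mul_tailLevel (m := m) (α := α) (p := 0.25) (by norm_num)
  have hβ1 : 1 / 2 ≤ 1 - α / (1 + α) := by
    have : α / (1 + α) ≤ 1 / 2 := by
      rw [div_le_div_iff₀ (by linarith) two_pos]
      linarith
    linarith
  have hh : ε ^ (1 - α / (1 + α)) ≤ 0.45 :=
    calc ε ^ (1 - α / (1 + α)) ≤ ε ^ (1 / 2 : ℝ) :=
          Real.rpow_le_rpow_of_exponent_ge hε0 (by linarith) hβ1
      _ ≤ 0.45 := by
        rw [← Real.sqrt_eq_rpow]
        exact Real.sqrt_le_iff.2 ⟨by norm_num, by linarith⟩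
  have k2 : ε ≤ 0.45 * ε ^ (α / (1 + α)) := by
    calc ε = ε ^ (1 - α / (1 + α)) * ε ^ (α / (1 + α)) := by
          rw [← Real.rpow_add hε0, sub_add_cancel, Real.rpow_one]
      _ ≤ _ := by gcongr
  have k4 : tailLevel m α 0.25 = 4 * (m * 0.25 ^ (α / (1 + α))) := by linarith
  have k5 : 0 < m * 0.25 ^ (α / (1 + α)) := by positivity
  rw [k4, show ε / 4 = 0.25 * ε by ring, Real.mul_rpow (by norm_num) hε0.le]
  calc 4 * (m * 0.25 ^ (α / (1 + α))) * ε
      ≤ 4 * (m * 0.25 ^ (α / (1 + α))) * (0.45 * ε ^ (α / (1 + α))) := by gcongr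
    _ = _ := by ring

/-- One-sided deviation bound for a clipped sum of `U + V`, where `U` is centred with a moment of
order `1 + α` and `V` is nonnegative. The bound holds simultaneously for all contaminated and
smaller samples `y` and all clipping levels close to the empirical quantiles of `y`. -/
theorem exists_event_sum_clamp_le
    (hmeas : ∀ i ∈ I, Measurable (Z i)) (hlaw : ∀ i ∈ I, μ.map (Z i) = P)
    (hind : iIndepFun (fun i : I => Z i) μ) (hn : Even n) {η u ε : ℝ} (hη : 0 ≤ η)
    (hout : (Iᶜ.card : ℝ) ≤ η * n) (hu : 2.38 ≤ u) (hε : ε * (n / 2) = 4 * η * n + 6 * u)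
    (hε0 : 0 < ε) (hε1 : ε < 1 / 2)
    {U V : E → ℝ} {m v α : ℝ} (hm : 0 < m) (hα : 0 < α) (hα1 : α ≤ 1)
    (hUm : Measurable U) (hVm : Measurable V) (hUint : Integrable U P) (hU0 : ∫ w, U w ∂P = 0)
    (hUi : Integrable (fun w => |U w| ^ (1 + α)) P) (hU : ∫ w, |U w| ^ (1 + α) ∂P ≤ m ^ (1 + α))
    (hv : 0 < v) (hV0 : ∀ w, 0 ≤ V w) (hVi : Integrable V P) (hV : ∫ w, V w ∂P ≤ v) :
    ∃ G : Set Ω, MeasurableSet G ∧ μ Gᶜ ≤ 3 * ENNReal.ofReal (Real.exp (-(5 * u))) ∧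
      ∀ ω ∈ G, ∀ (y : Fin n → ℝ) (a b : ℝ), (∀ i ∈ I, y i ≤ U (Z i ω) + V (Z i ω)) →
      (∀ t, t < b → ε * (n / 2) - 1 ≤
        (Finset.univ.filter fun i : Fin n => i.val < n / 2 ∧ t < y i).card) →
      (∀ t, t < a → (Finset.univ.filter fun i : Fin n => i.val < n / 2 ∧ y i ≤ t).card ≤
        ε * (n / 2) + 1) →
      ∑ i : Fin n with n / 2 ≤ i.val, max a (min (y i) b) ≤
        n / 2 * (27.6 * (m * (ε / 4) ^ (α / (1 + α))) + 56.2 * v) := by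
  have hn0 : (0 : ℝ) ≤ n := n.cast_nonneg
  set Y := m * (ε / 4) ^ (α / (1 + α)) with hY
  have hY0 : 0 < Y := by positivity
  -- The tail mass `0.16 ε` is divided between `U` and `V`; the shares give the coefficients `25/3`
  -- and `25` in the bound for `ε * B`.
  set B := tailLevel m α (0.12 * ε) + v / (0.04 * ε) with hB
  have h12 : 0 < 0.12 * ε := by positivity
  have h04 : 0 < 0.04 * ε := by positivity
  have hQ := tailLevel_pos (α := α) hm h12
  have hvp : 0 < v / (0.04 * ε) := by positivity
  have hB0 : 0 < B := by linarith
  have hp : P.real {w | B < |U w| + V w} ≤ 0.16 * ε :=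
    (measureReal_add_lt hm hα hUi hU hv hV0 hVi hV h12 h04).trans_eq (by ring)
  have hsq : ∫ w, (min (|U w| + V w) B / B) ^ 2 ∂P ≤ 0.32 * ε :=
    (integral_sq_min_le hm hα hα1 hUm hVm hUi hU hv hV0 hVi hV h12 h04 hB).trans_eq (by ring)
  have hεB : ε * B ≤ 25 / 3 * Y + 25 * v := by
    have h1 := mul_tailLevel (m := m) (α := α) h12
    have h2 := mul_tailLevel_le (c := 1) (q := ε / 4) hm hα hα1 h12 le_rfl (by positivity)
      (by linarith)
    have h3 : ε * (v / (0.04 * ε)) = 25 * v := by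
      field_simp
      norm_num
    rw [hB, mul_add, h3]
    have h4 : ε * tailLevel m α (0.12 * ε) ≤ 25 / 3 * Y := by linarith
    linarith
  rcases le_or_gt ε 0.2 with hsmall | hlarge
  · have hπ : 0 < 3.2 * ε := by positivity
    obtain ⟨A, hA1, hA2⟩ := exists_quantile (P := P) (hUm.add hVm) hπ (by linarith)
    simp only [Pi.add_apply] at hA1 hA2
    have hAle : A ≤ tailLevel m α 0.25 + 10 * v := by
      -- The mass at or above the quantile is at least `1 - 3.2 * 0.2 = 0.36`, more than the `0.25 +
      -- 0.1` allowed by the tail levels.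
      by_contra! hlt
      have h1 := measureReal_add_lt hm hα hUi hU hv hV0 hVi hV (p := 0.25) (p' := 0.1)
        (by norm_num) (by norm_num)
      have h2 : P.real {w | A ≤ U w + V w} ≤ 0.25 + 0.1 := by
        refine (measureReal_mono fun w hw => ?_).trans h1
        have hw' : A ≤ U w + V w := hw
        show tailLevel m α 0.25 + v / 0.1 < |U w| + V w
        have : v / 0.1 = 10 * v := by
          field_simp
          norm_num
        linarith [le_abs_self (U w)]
      have h3 : P.real {w | U w + V w < A} + P.real {w | A ≤ U w + V w} = 1 := by
        have := probReal_add_probReal_compl (μ := P)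
          (measurableSet_lt (hUm.add hVm) (measurable_const (a := A)))
        convert! this using 3
        ext w
        simp
      linarith
    have hQ25 : tailLevel m α 0.25 ≤ tailLevel m α (0.12 * ε) :=
      tailLevel_anti hm hα h12 (by linarith)
    have hv10 : 10 * v ≤ v / (0.04 * ε) := by
      rw [le_div_iff₀ h04]
      have : v * ε ≤ v * 0.2 := by gcongr
      linarith
    have hAB : A ≤ B := by linarith
    have hBA : -B ≤ A := by
      by_contra! hlt
      have : P.real {w | U w + V w ≤ A} ≤ 0.16 * ε := by
        refine (measureReal_mono fun w hw => ?_).trans hp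
        have hw' : U w + V w ≤ A := hw
        show B < |U w| + V w
        linarith [neg_abs_le (U w), hV0 w]
      linarith
    have he := integral_clamp_le_of_quantile hm hα hUm hVm hUint hU0 hUi hU hV0 hVi hV hπ
      hAB hBA hA1
    have hA0 := le_max_right A 0
    obtain ⟨G, hG, hGμ, hGω⟩ := exists_event_sum_clamp_le_of_levels hmeas hlaw hind hn hη hout hu hε
      hUm hVm hV0 hB0 hAB hBA hp hsq (by positivity) he
      (measure_count_le_of_small hmeas hlaw hind hn hη hout hu hε hε0 hsmall (hUm.add hVm) hA2)
    refine ⟨G, hG, hGμ, fun ω hω y a b h1 h2 h3 => (hGω ω hω y a b h1 h2 h3).trans ?_⟩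
    refine mul_le_mul_of_nonneg_left ?_ (by positivity)
    have e1 : m * (3.2 * ε) ^ (α / (1 + α)) ≤ 3.6 * Y :=
      mul_tailLevel_le hm hα hα1 hπ (by norm_num) (by positivity) (by linarith)
    have e2 := tailLevel_mul_le hm hα hα1 hε0 hsmall
    rw [← hY] at e2
    have e3 : max A 0 * (3.2 * ε) ≤ 3.2 * (1.8 * Y) + 6.4 * v := by
      have : max A 0 ≤ tailLevel m α 0.25 + 10 * v :=
        max_le hAle (by have := tailLevel_pos (α := α) hm (p := 0.25) (by norm_num); linarith)
      have h4 : max A 0 * (3.2 * ε) ≤ (tailLevel m α 0.25 + 10 * v) * (3.2 * ε) := by gcongr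
      have h5 : v * ε ≤ v * 0.2 := by gcongr
      linarith
    rw [mul_assoc 1.06454 ε B]
    linarith only [hεB, e1, e3, hY0, hv]
  · set A := tailLevel m α 0.065 + v / 0.035 with hA
    have hQ65 : tailLevel m α 0.065 ≤ tailLevel m α (0.12 * ε) :=
      tailLevel_anti hm hα h12 (by linarith)
    have hv35 : v / 0.035 ≤ v / (0.04 * ε) :=
      div_le_div_of_nonneg_left hv.le h04 (by linarith)
    have hAB : A ≤ B := by linarith
    have hQ0 := tailLevel_pos (α := α) hm (p := 0.065) (by norm_num)
    have hv0 : 0 < v / 0.035 := by positivity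
    have hA1 : P.real {w | A < U w + V w} ≤ 0.1 := by
      refine (measureReal_mono fun w hw => ?_).trans ((measureReal_add_lt hm hα hUi hU hv hV0 hVi hV
        (p := 0.065) (p' := 0.035) (by norm_num) (by norm_num)).trans_eq (by norm_num))
      have hw' : A < U w + V w := hw
      show A < |U w| + V w
      linarith [le_abs_self (U w)]
    have he := integral_clamp_le_of_tailLevel hm hα hUm hVm hUi hU hV0 hVi hV (p := 0.065)
      (by norm_num) hv0.le hA hAB
    obtain ⟨G, hG, hGμ, hGω⟩ := exists_event_sum_clamp_le_of_levels hmeas hlaw hind hn hη hout hu hε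
      hUm hVm hV0 hB0 hAB (by linarith) hp hsq (by positivity) he
      (measure_count_le_of_large hmeas hlaw hind hn hη hout hu hε hε1 (hUm.add hVm) hA1)
    refine ⟨G, hG, hGμ, fun ω hω y a b h1 h2 h3 => (hGω ω hω y a b h1 h2 h3).trans ?_⟩
    refine mul_le_mul_of_nonneg_left ?_ (by positivity)
    have e1 : m * 0.065 ^ (α / (1 + α)) ≤ 1.1402 * Y :=
      mul_tailLevel_le hm hα hα1 (by norm_num) (by norm_num) (by positivity) (by linarith)
    have e2 := mul_tailLevel (m := m) (α := α) (p := 0.065) (by norm_num)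
    have e3 : v / 0.035 ≤ 28.5715 * v := by
      rw [div_le_iff₀ (by norm_num)]
      linarith
    rw [mul_assoc 1.06454 ε B]
    -- This case fixes the constants: `1.1402 * (1 + 1/0.065) + 1.06454 * 25/3 ≤ 27.6` and `28.5715
    -- + 1 + 1.06454 * 25 ≤ 56.2`.
    linarith only [hεB, e1, e2, e3, hY0, hv, hA]

end Levels

/-! ### The sample partial derivatives -/

section Loss

variable {d : ℕ} {𝒴 : Set ℝ} {ℓ : ℝ → 𝒴 → ℝ} {γ q : ℝ}

theorem LossAssumption.hasDerivAt (hloss : LossAssumption ℓ γ q) (z : ℝ) (y : 𝒴) :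
    HasDerivAt (fun t => ℓ t y) (lossDeriv ℓ z y) z :=
  (hloss.differentiable y z).hasDerivAt

/-- The derivative is the pointwise limit of jointly measurable difference quotients with steps `1 /
(k + 1)`. -/
theorem LossAssumption.measurable_lossDeriv (hloss : LossAssumption ℓ γ q) :
    Measurable fun p : ℝ × 𝒴 => lossDeriv ℓ p.1 p.2 := by
  have hseq : Filter.Tendsto (fun k : ℕ => ((k : ℝ) + 1)⁻¹) Filter.atTop
      (nhdsWithin 0 {0}ᶜ) := by
    refine tendsto_nhdsWithin_iff.2 ⟨?_, .of_forall fun k => ?_⟩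
    · simpa using tendsto_one_div_add_atTop_nhds_zero_nat (𝕜 := ℝ)
    · have : ((k : ℝ) + 1)⁻¹ ≠ 0 := by positivity
      simpa using this
  refine measurable_of_tendsto_metrizable
    (f := fun (k : ℕ) (p : ℝ × 𝒴) => (((k : ℝ) + 1)⁻¹)⁻¹ *
      (ℓ (p.1 + ((k : ℝ) + 1)⁻¹) p.2 - ℓ p.1 p.2)) (fun k => ?_) ?_
  · refine Measurable.const_mul ?_ _
    exact (hloss.measurable.comp ((measurable_fst.add_const _).prodMk measurable_snd)).sub
      hloss.measurable
  · rw [tendsto_pi_nhds]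
    intro p
    have h := (hloss.hasDerivAt p.1 p.2).tendsto_slope_zero
    exact h.comp hseq

theorem measurable_coord (j : Fin d) : Measurable fun w : Vec d × 𝒴 => w.1 j := by
  fun_prop

theorem measurable_inner_fst (θ : Vec d) : Measurable fun w : Vec d × 𝒴 => inner ℝ w.1 θ := by
  fun_prop

theorem LossAssumption.measurable_samplePartial (hloss : LossAssumption ℓ γ q) (j : Fin d)
    (θ : Vec d) : Measurable (samplePartial ℓ j θ) :=
  (hloss.measurable_lossDeriv.comp ((measurable_inner_fst θ).prodMk measurable_snd)).mul
    (measurable_coord j)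

theorem abs_coord_le_norm (x : Vec d) (j : Fin d) : |x j| ≤ ‖x‖ := by
  simpa using PiLp.norm_apply_le x j

theorem LossAssumption.nonneg_smoothness (hloss : LossAssumption ℓ γ q) [Nonempty 𝒴] : 0 ≤ γ := by
  have h := hloss.smooth 1 0 (Classical.arbitrary 𝒴)
  simp only [sub_zero, abs_one, mul_one] at h
  exact (abs_nonneg _).trans h

/-- This is the envelope for the oscillation over a ball. One factor `‖w.1‖` comes from the argument
of `ℓ'`, the other from the coordinate. -/
theorem LossAssumption.abs_samplePartial_sub_le (hloss : LossAssumption ℓ γ q) (j : Fin d)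
    (θ θ' : Vec d) (w : Vec d × 𝒴) :
    |samplePartial ℓ j θ w - samplePartial ℓ j θ' w| ≤ γ * ‖w.1‖ ^ 2 * ‖θ - θ'‖ := by
  have : Nonempty 𝒴 := ⟨w.2⟩
  have hγ := hloss.nonneg_smoothness
  have hin : |inner ℝ w.1 θ - inner ℝ w.1 θ'| ≤ ‖w.1‖ * ‖θ - θ'‖ := by
    rw [← inner_sub_right]
    exact abs_real_inner_le_norm _ _
  rw [samplePartial, samplePartial, ← sub_mul, abs_mul]
  calc _ ≤ γ * |inner ℝ w.1 θ - inner ℝ w.1 θ'| * |w.1 j| := by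
        gcongr
        exact hloss.smooth _ _ _
    _ ≤ γ * (‖w.1‖ * ‖θ - θ'‖) * ‖w.1‖ := by
        gcongr
        exact abs_coord_le_norm _ _
    _ = _ := by ring

theorem rpow_le_one_add_rpow {x a b : ℝ} (hx : 0 ≤ x) (ha : 0 ≤ a) (hab : a ≤ b) :
    x ^ a ≤ 1 + x ^ b := by
  rcases le_total x 1 with h | h
  · have := Real.rpow_le_one hx h ha
    have := Real.rpow_nonneg hx b
    linarith
  · have := Real.rpow_le_rpow_of_exponent_le h hab
    linarith

variable {P : Measure (Vec d × 𝒴)} [IsProbabilityMeasure P] {α : ℝ}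

theorem integrable_sq_norm
    (hX : ∀ j : Fin d, Integrable (fun w => |w.1 j| ^ max 2 (q * (α + 1))) P) :
    Integrable (fun w => ‖w.1‖ ^ 2) P := by
  have h : ∀ j : Fin d, Integrable (fun w => (w.1 j) ^ 2) P := fun j => by
    refine ((integrable_const 1).add (hX j)).mono'
      ((measurable_coord j).pow_const 2).aestronglyMeasurable (.of_forall fun w => ?_)
    rw [Real.norm_eq_abs, abs_of_nonneg (sq_nonneg _), ← sq_abs, ← Real.rpow_two]
    exact rpow_le_one_add_rpow (abs_nonneg _) (by norm_num) (le_max_left _ _)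
  have : (fun w : Vec d × 𝒴 => ‖w.1‖ ^ 2) = fun w => ∑ j, (w.1 j) ^ 2 := by
    ext w
    rw [EuclideanSpace.norm_sq_eq]
    simp
  rw [this]
  exact integrable_finsetSum _ fun j _ => h j

theorem integrable_norm_fst (h2 : Integrable (fun w => ‖w.1‖ ^ 2) P) :
    Integrable (fun w => ‖w.1‖) P := by
  refine ((integrable_const 1).add h2).mono' (by fun_prop) (.of_forall fun w => ?_)
  simp only [Pi.add_apply, norm_norm]
  nlinarith [sq_nonneg (‖w.1‖ - 1), norm_nonneg w.1]

theorem rpow_abs_sub_le {z y s : ℝ} (hs0 : 0 ≤ s) (hs1 : s ≤ 1) :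
    |z - y| ^ s ≤ |z| ^ s + |y| ^ s :=
  (Real.rpow_le_rpow (abs_nonneg _) (abs_sub z y) hs0).trans
    (Real.rpow_add_le_add_rpow (abs_nonneg _) (abs_nonneg _) hs0 hs1)

theorem LossAssumption.integrable_samplePartial (hloss : LossAssumption ℓ γ q) (hα : 0 < α)
    (h2 : Integrable (fun w => ‖w.1‖ ^ 2) P) (j : Fin d)
    (hYX : Integrable (fun w => (|(w.2 : ℝ)| ^ (q - 1) * |w.1 j|) ^ (1 + α)) P) (θ : Vec d) :
    Integrable (samplePartial ℓ j θ) P := by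
  obtain ⟨C₁, C₂, hC₁, hC₂, hg⟩ := hloss.deriv_growth
  have h1 := integrable_norm_fst h2
  have hbd : Integrable (fun w : Vec d × 𝒴 => C₁ * ‖w.1‖ + C₂ * (‖w.1‖ + ‖θ‖ * ‖w.1‖ ^ 2 +
      (1 + (|(w.2 : ℝ)| ^ (q - 1) * |w.1 j|) ^ (1 + α)))) P :=
    (h1.const_mul C₁).add (((h1.add (h2.const_mul _)).add ((integrable_const 1).add hYX)).const_mul _)
  refine hbd.mono' (hloss.measurable_samplePartial j θ).aestronglyMeasurable
    (.of_forall fun w => ?_)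
  have hq0 : 0 ≤ q - 1 := by linarith [hloss.one_le_degree]
  have hq1 : q - 1 ≤ 1 := by linarith [hloss.degree_le_two]
  have hx := abs_coord_le_norm w.1 j
  have hz : |inner ℝ w.1 θ| ^ (q - 1) ≤ 1 + ‖θ‖ * ‖w.1‖ := by
    refine (rpow_le_one_add_rpow (abs_nonneg _) hq0 hq1).trans ?_
    rw [Real.rpow_one, mul_comm ‖θ‖]
    gcongr
    exact abs_real_inner_le_norm _ _
  have hy : |(w.2 : ℝ)| ^ (q - 1) * |w.1 j| ≤
      1 + (|(w.2 : ℝ)| ^ (q - 1) * |w.1 j|) ^ (1 + α) := by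
    have := rpow_le_one_add_rpow (x := |(w.2 : ℝ)| ^ (q - 1) * |w.1 j|) (a := 1) (b := 1 + α)
      (by positivity) zero_le_one (by linarith)
    rwa [Real.rpow_one] at this
  rw [Real.norm_eq_abs, samplePartial, abs_mul]
  calc |lossDeriv ℓ (inner ℝ w.1 θ) w.2| * |w.1 j|
      ≤ (C₁ + C₂ * ((1 + ‖θ‖ * ‖w.1‖) + |(w.2 : ℝ)| ^ (q - 1))) * |w.1 j| := by
        gcongr
        refine (hg _ _).trans ?_
        gcongr
        exact (rpow_abs_sub_le hq0 hq1).trans (by gcongr)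
    _ = C₁ * |w.1 j| + C₂ * (|w.1 j| + ‖θ‖ * (‖w.1‖ * |w.1 j|) +
          |(w.2 : ℝ)| ^ (q - 1) * |w.1 j|) := by ring
    _ ≤ _ := by
        rw [pow_two ‖w.1‖]
        gcongr

theorem LossAssumption.integrable_loss (hloss : LossAssumption ℓ γ q)
    (h2 : Integrable (fun w => ‖w.1‖ ^ 2) P)
    (hY : Integrable (fun w => |(w.2 : ℝ)| ^ q) P) (θ : Vec d) :
    Integrable (fun w => ℓ (inner ℝ w.1 θ) w.2) P := by
  obtain ⟨C₁, C₂, hC₁, hC₂, hg⟩ := hloss.growth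
  have hq0 : 0 ≤ q := by linarith [hloss.one_le_degree]
  have hbd : Integrable (fun w : Vec d × 𝒴 => C₁ + C₂ * (2 ^ q * ((1 + ‖θ‖ ^ 2 * ‖w.1‖ ^ 2) +
      |(w.2 : ℝ)| ^ q))) P :=
    (integrable_const C₁).add (((((integrable_const 1).add (h2.const_mul _)).add hY).const_mul
      _).const_mul _)
  refine hbd.mono' (hloss.measurable.comp ((measurable_inner_fst θ).prodMk
    measurable_snd)).aestronglyMeasurable (.of_forall fun w => ?_)
  refine (hg _ _).trans ?_
  gcongr
  set z := inner ℝ w.1 θ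
  set y : ℝ := (w.2 : ℝ)
  have hz : |z| ^ q ≤ 1 + ‖θ‖ ^ 2 * ‖w.1‖ ^ 2 := by
    refine (rpow_le_one_add_rpow (abs_nonneg _) hq0 hloss.degree_le_two).trans ?_
    rw [Real.rpow_two, ← mul_pow, mul_comm ‖θ‖]
    gcongr
    exact abs_real_inner_le_norm _ _
  have hmax : |z - y| ≤ 2 * max |z| |y| := by
    have := abs_sub z y
    linarith [le_max_left |z| |y|, le_max_right |z| |y|]
  calc |z - y| ^ q ≤ (2 * max |z| |y|) ^ q := Real.rpow_le_rpow (abs_nonneg _) hmax hq0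
    _ = 2 ^ q * (max |z| |y|) ^ q := Real.mul_rpow two_pos.le (by positivity)
    _ ≤ 2 ^ q * (|z| ^ q + |y| ^ q) := by
        gcongr
        have h1 : 0 ≤ |z| ^ q := by positivity
        have h2 : 0 ≤ |y| ^ q := by positivity
        rcases le_total |z| |y| with h | h
        · rw [max_eq_right h]
          linarith
        · rw [max_eq_left h]
          linarith
    _ ≤ _ := by gcongr

/-- Differentiation of the risk under the expectation. -/
theorem LossAssumption.riskPartial_eq (hloss : LossAssumption ℓ γ q) (hα : 0 < α)
    (h2 : Integrable (fun w => ‖w.1‖ ^ 2) P) (j : Fin d)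
    (hYX : Integrable (fun w => (|(w.2 : ℝ)| ^ (q - 1) * |w.1 j|) ^ (1 + α)) P)
    (hY : Integrable (fun w => |(w.2 : ℝ)| ^ q) P) (θ : Vec d) :
    riskPartial ℓ P j θ = ∫ w, samplePartial ℓ j θ w ∂P := by
  set v : Vec d := EuclideanSpace.single j 1 with hv
  have hvn : ‖v‖ = 1 := by simp [hv]
  have hinner : ∀ x : Vec d, inner ℝ x v = x j := fun x => by
    simp [hv, EuclideanSpace.inner_single_right]
  have hS := hloss.integrable_samplePartial hα h2 j hYX θ
  have key := hasDerivAt_integral_of_dominated_loc_of_deriv_le (μ := P) (𝕜 := ℝ)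
    (F := fun (t : ℝ) (w : Vec d × 𝒴) => ℓ (inner ℝ w.1 (θ + t • v)) w.2)
    (F' := fun t w => samplePartial ℓ j (θ + t • v) w) (x₀ := 0) (s := Metric.ball 0 1)
    -- For `|t| < 1` smoothness dominates the derivative at `θ + t • v` by its value at `θ` plus the
    -- envelope.
    (bound := fun w => |samplePartial ℓ j θ w| + γ * ‖w.1‖ ^ 2)
    (Metric.ball_mem_nhds 0 one_pos)
    (.of_forall fun t => (hloss.integrable_loss h2 hY (θ + t • v)).aestronglyMeasurable)
    (hloss.integrable_loss h2 hY (θ + (0 : ℝ) • v))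
    (hloss.measurable_samplePartial j _).aestronglyMeasurable
    (.of_forall fun w t ht => by
      have : Nonempty 𝒴 := ⟨w.2⟩
      have hγ := hloss.nonneg_smoothness
      have h := hloss.abs_samplePartial_sub_le j (θ + t • v) θ w
      have ht' : |t| ≤ 1 := by simpa using (le_of_lt (Metric.mem_ball.1 ht))
      rw [add_sub_cancel_left, norm_smul, hvn, mul_one, Real.norm_eq_abs] at h
      have h3 : γ * ‖w.1‖ ^ 2 * |t| ≤ γ * ‖w.1‖ ^ 2 :=
        mul_le_of_le_one_right (by positivity) ht'
      rw [Real.norm_eq_abs]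
      have h4 := abs_sub_abs_le_abs_sub (samplePartial ℓ j (θ + t • v) w) (samplePartial ℓ j θ w)
      linarith)
    (hS.abs.add (h2.const_mul γ))
    (.of_forall fun w t _ => by
      have hlin : HasDerivAt (fun t : ℝ => inner ℝ w.1 (θ + t • v)) (w.1 j) t := by
        have h5 : (fun t : ℝ => inner ℝ w.1 (θ + t • v)) =
            fun t : ℝ => inner ℝ w.1 θ + t * w.1 j := by
          ext t
          rw [inner_add_right, inner_smul_right, hinner]
        rw [h5]
        simpa using ((hasDerivAt_id t).mul_const (w.1 j)).const_add (inner ℝ w.1 θ)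
      exact (hloss.hasDerivAt _ w.2).comp t hlin)
  have hd := key.2.deriv
  rw [riskPartial, lineDeriv]
  simp only [zero_smul, add_zero] at hd
  exact hd

end Loss

/-! ### The trimmed mean and its order statistics -/

section TrimmedMean

variable {n : ℕ} {ε : ℝ} {v : Fin n → ℝ}

/-- The clipping levels of the trimmed mean are close to the empirical quantiles. -/
theorem orderStat_counts (hn : Even n) (hε0 : 0 < ε) (hε1 : ε < 1 / 2) (hεn : 1 ≤ ε * (n / 2)) :
    (∀ t, t < orderStat (firstHalf v) ⌊(1 - ε) * n / 2⌋₊ → ε * (n / 2) - 1 ≤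
      (Finset.univ.filter fun i : Fin n => i.val < n / 2 ∧ t < v i).card) ∧
    (∀ t, t < orderStat (firstHalf v) ⌊ε * n / 2⌋₊ →
      (Finset.univ.filter fun i : Fin n => i.val < n / 2 ∧ v i ≤ t).card ≤ ε * (n / 2) + 1) ∧
    (∀ t, orderStat (firstHalf v) ⌊ε * n / 2⌋₊ < t → ε * (n / 2) - 1 ≤
      (Finset.univ.filter fun i : Fin n => i.val < n / 2 ∧ v i < t).card) ∧
    (∀ t, orderStat (firstHalf v) ⌊(1 - ε) * n / 2⌋₊ < t →
      (Finset.univ.filter fun i : Fin n => i.val < n / 2 ∧ t ≤ v i).card ≤ ε * (n / 2) + 1) := by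
  classical
  have hN : ((n / 2 : ℕ) : ℝ) = n / 2 := by
    obtain ⟨k, rfl⟩ := hn
    rw [← two_mul, Nat.mul_div_cancel_left k two_pos]
    push_cast
    ring
  have hn0 : (0 : ℝ) ≤ n / 2 := by positivity
  set k := ⌊ε * n / 2⌋₊ with hk
  set l := ⌊(1 - ε) * n / 2⌋₊ with hl
  have hk1 : (k : ℝ) ≤ ε * (n / 2) := by
    rw [← mul_div_assoc]
    exact Nat.floor_le (by positivity)
  have hk2 : ε * (n / 2) < k + 1 := by
    rw [← mul_div_assoc]
    exact Nat.lt_floor_add_one _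
  have hl1 : (l : ℝ) ≤ (1 - ε) * (n / 2) := by
    rw [← mul_div_assoc]
    have : 0 ≤ 1 - ε := by linarith
    exact Nat.floor_le (by positivity)
  have hl2 : (1 - ε) * (n / 2) < l + 1 := by
    rw [← mul_div_assoc]
    exact Nat.lt_floor_add_one _
  have hk0 : 1 ≤ k := by
    have h : (0 : ℝ) < k := by linarith
    exact_mod_cast h
  have hkl : k ≤ l := by
    refine Nat.floor_le_floor ?_
    have : ε ≤ 1 - ε := by linarith
    gcongr
  have hlN : l ≤ n / 2 := by
    have h : (l : ℝ) ≤ (n / 2 : ℕ) := by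
      rw [hN]
      nlinarith
    exact_mod_cast h
  have hsplit : ∀ (p : ℝ → Prop) [DecidablePred p],
      ((Finset.univ.filter fun i : Fin n => i.val < n / 2 ∧ p (v i)).card : ℝ) +
      (Finset.univ.filter fun i : Fin n => i.val < n / 2 ∧ ¬ p (v i)).card = n / 2 := by
    intro p _
    have h := Finset.card_filter_add_card_filter_not
      (s := Finset.univ.filter fun i : Fin n => i.val < n / 2) (fun i => p (v i))
    rw [Finset.filter_filter, Finset.filter_filter] at h
    rw [← card_firstHalf hn]
    exact_mod_cast h
  have hgt : ∀ (t : ℝ) (a : ℕ), 1 ≤ a → a ≤ n / 2 → t < orderStat (firstHalf v) a →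
      (n / 2 : ℝ) + 1 ≤
        (Finset.univ.filter fun i : Fin n => i.val < n / 2 ∧ t < v i).card + a := by
    intro t a h1 h2 h3
    have h := card_lt_of_lt_orderStat (firstHalf v) h1 h2 h3
    rw [card_filter_firstHalf v (fun x => t < x)] at h
    rw [← hN]
    exact_mod_cast h
  have hlt : ∀ (t : ℝ) (a : ℕ), 1 ≤ a → a ≤ n / 2 → orderStat (firstHalf v) a < t →
      (a : ℝ) ≤ (Finset.univ.filter fun i : Fin n => i.val < n / 2 ∧ v i < t).card := by
    intro t a h1 h2 h3
    have h := card_lt_of_orderStat_lt (firstHalf v) h1 h2 h3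
    rw [card_filter_firstHalf v (fun x => x < t)] at h
    exact_mod_cast h
  -- A common slack of one absorbs both floors; the last two claims are the first two for the
  -- negated sample.
  refine ⟨fun t ht => ?_, fun t ht => ?_, fun t ht => ?_, fun t ht => ?_⟩
  · have := hgt t l (hk0.trans hkl) hlN ht
    linarith
  · have h1 := hgt t k hk0 (hkl.trans hlN) ht
    have h2 := hsplit (fun x => x ≤ t)
    simp only [not_le] at h2
    linarith
  · have := hlt t k hk0 (hkl.trans hlN) ht
    linarith
  · have h1 := hlt t l (hk0.trans hkl) hlN ht
    have h2 := hsplit (fun x => x < t)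
    simp only [not_lt] at h2
    linarith

theorem trimmedMean_sub_eq (hn : Even n) (hn0 : 0 < n) (g : ℝ) :
    trimmedMean ε v - g = 2 / (n : ℝ) * ∑ i : Fin n with n / 2 ≤ i.val,
      (max (orderStat (firstHalf v) ⌊ε * n / 2⌋₊)
        (min (v i) (orderStat (firstHalf v) ⌊(1 - ε) * n / 2⌋₊)) - g) := by
  have hn0' : (0 : ℝ) < n := by exact_mod_cast hn0
  rw [trimmedMean, Finset.sum_sub_distrib, Finset.sum_const, nsmul_eq_mul, card_secondHalf hn]
  field_simp

theorem trimmedMean_sub_le (hn : Even n) (hn0 : 0 < n) {g C : ℝ}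
    (h : ∑ i : Fin n with n / 2 ≤ i.val,
      max (orderStat (firstHalf v) ⌊ε * n / 2⌋₊ - g)
        (min (v i - g) (orderStat (firstHalf v) ⌊(1 - ε) * n / 2⌋₊ - g)) ≤ n / 2 * C) :
    trimmedMean ε v - g ≤ C := by
  have hn0' : (0 : ℝ) < n := by exact_mod_cast hn0
  rw [trimmedMean_sub_eq hn hn0]
  simp only [← max_sub_sub_right, ← min_sub_sub_right]
  calc _ ≤ 2 / (n : ℝ) * (n / 2 * C) := by gcongr
    _ = C := by field_simp

theorem sub_trimmedMean_le (hn : Even n) (hn0 : 0 < n) {g C : ℝ}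
    (h : ∑ i : Fin n with n / 2 ≤ i.val,
      max (g - orderStat (firstHalf v) ⌊(1 - ε) * n / 2⌋₊)
        (min (g - v i) (g - orderStat (firstHalf v) ⌊ε * n / 2⌋₊)) ≤ n / 2 * C) :
    g - trimmedMean ε v ≤ C := by
  have hn0' : (0 : ℝ) < n := by exact_mod_cast hn0
  rw [← neg_sub, trimmedMean_sub_eq hn hn0, ← mul_neg, ← Finset.sum_neg_distrib]
  calc _ ≤ 2 / (n : ℝ) * (n / 2 * C) := by
        gcongr
        refine (Finset.sum_le_sum fun i _ => ?_).trans h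
        set a := orderStat (firstHalf v) ⌊ε * n / 2⌋₊
        set b := orderStat (firstHalf v) ⌊(1 - ε) * n / 2⌋₊
        rw [neg_sub]
        -- Negation exchanges the order of clipping; only an inequality is needed, so `a ≤ b` need
        -- not be known.
        rcases le_total (v i) b with hb | hb
        · rw [min_eq_left hb]
          refine le_max_of_le_right (le_min ?_ ?_)
          · linarith [le_max_right a (v i)]
          · linarith [le_max_left a (v i)]
        · rw [min_eq_right hb]
          refine le_max_of_le_left ?_
          linarith [le_max_right a b]
    _ = C := by field_simp

end TrimmedMean

/-! ### Uniform deviation bound -/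

section Uniform

variable {d n : ℕ} {𝒴 : Set ℝ} {Ω : Type*} [MeasurableSpace Ω] {μ : Measure Ω}
  {P : Measure (Vec d × 𝒴)} {ℓ : ℝ → 𝒴 → ℝ} {γ q α η δ : ℝ}
  {Z : Fin n → Ω → Vec d × 𝒴} {I : Finset (Fin n)}

theorem integrable_rpow_of_partialMoment_le (hloss : LossAssumption ℓ γ q)
    {j : Fin d} {θ : Vec d} {M : ℝ} (hM : 0 ≤ M)
    (h : partialMoment ℓ P α j θ ≤ ENNReal.ofReal M) :
    Integrable (fun w => |samplePartial ℓ j θ w - ∫ w', samplePartial ℓ j θ w' ∂P| ^ (1 + α)) P ∧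
      ∫ w, |samplePartial ℓ j θ w - ∫ w', samplePartial ℓ j θ w' ∂P| ^ (1 + α) ∂P ≤ M := by
  have hm : Measurable fun w =>
      |samplePartial ℓ j θ w - ∫ w', samplePartial ℓ j θ w' ∂P| ^ (1 + α) :=
    (((hloss.measurable_samplePartial j θ).sub_const _).norm).pow_const _
  have hnn : ∀ w, 0 ≤ |samplePartial ℓ j θ w - ∫ w', samplePartial ℓ j θ w' ∂P| ^ (1 + α) :=
    fun w => Real.rpow_nonneg (abs_nonneg _) _
  refine ⟨⟨hm.aestronglyMeasurable, ?_⟩, ?_⟩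
  · rw [hasFiniteIntegral_iff_ofReal (.of_forall hnn)]
    exact h.trans_lt ENNReal.ofReal_lt_top
  · rw [integral_eq_lintegral_of_nonneg_ae (.of_forall hnn) hm.aestronglyMeasurable]
    exact ENNReal.toReal_le_of_le_ofReal hM h

/-- The deviation bound over a ball of radius `r` around a parameter `θ₀`. -/
theorem exists_event_local [IsProbabilityMeasure P]
    (hmeas : ∀ i ∈ I, Measurable (Z i)) (hlaw : ∀ i ∈ I, μ.map (Z i) = P)
    (hind : iIndepFun (fun i : I => Z i) μ) (hn : Even n) (hn0 : 0 < n) {u ε : ℝ} (hη : 0 ≤ η)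
    (hout : (Iᶜ.card : ℝ) ≤ η * n) (hu : 2.38 ≤ u) (hε : ε * (n / 2) = 4 * η * n + 6 * u)
    (hε0 : 0 < ε) (hε1 : ε < 1 / 2) (hα : 0 < α) (hα1 : α ≤ 1)
    (hloss : LossAssumption ℓ γ q) (h2 : Integrable (fun w => ‖w.1‖ ^ 2) P) {j : Fin d}
    {θ₀ : Vec d} (hint : Integrable (samplePartial ℓ j θ₀) P) {m v r : ℝ} (hm : 0 < m)
    (hUi : Integrable
      (fun w => |samplePartial ℓ j θ₀ w - ∫ w', samplePartial ℓ j θ₀ w' ∂P| ^ (1 + α)) P)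
    (hU : ∫ w, |samplePartial ℓ j θ₀ w - ∫ w', samplePartial ℓ j θ₀ w' ∂P| ^ (1 + α) ∂P ≤
      m ^ (1 + α))
    (hr : 0 ≤ r) (hv : 0 < v) (hrv : meanSmoothness P γ * r ≤ v) :
    ∃ G : Set Ω, MeasurableSet G ∧ μ Gᶜ ≤ 6 * ENNReal.ofReal (Real.exp (-(5 * u))) ∧
      ∀ ω ∈ G, ∀ θ : Vec d, ‖θ - θ₀‖ ≤ r →
        |gradTM ℓ ε (fun i => Z i ω) j θ - ∫ w', samplePartial ℓ j θ₀ w' ∂P| ≤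
          27.6 * (m * (ε / 4) ^ (α / (1 + α))) + 56.2 * v := by
  have hne : Nonempty (Vec d × 𝒴) := P.nonempty_of_neZero
  have : Nonempty 𝒴 := hne.map Prod.snd
  have hγ := hloss.nonneg_smoothness
  set g := ∫ w', samplePartial ℓ j θ₀ w' ∂P with hg
  have hSm := hloss.measurable_samplePartial j θ₀
  let V : Vec d × 𝒴 → ℝ := fun w => γ * ‖w.1‖ ^ 2 * r
  have hVm : Measurable V := by fun_prop
  have hV0 : ∀ w, 0 ≤ V w := fun w => by positivity
  have hVi : Integrable V P := (h2.const_mul γ).mul_const r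
  have hV : ∫ w, V w ∂P ≤ v := by
    simp only [V]
    rw [integral_mul_const, integral_const_mul]
    exact hrv
  have hUint : Integrable (fun w => samplePartial ℓ j θ₀ w - g) P := hint.sub (integrable_const _)
  have hU0 : ∫ w, (samplePartial ℓ j θ₀ w - g) ∂P = 0 := by
    rw [integral_sub hint (integrable_const _)]
    simp [hg]
  obtain ⟨G₁, hG₁, hμ₁, hb₁⟩ := exists_event_sum_clamp_le hmeas hlaw hind hn hη hout hu hε hε0 hε1
    hm hα hα1 (hSm.sub_const g) hVm hUint hU0 hUi hU hv hV0 hVi hV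
  have hneg : ∀ w, |g - samplePartial ℓ j θ₀ w| = |samplePartial ℓ j θ₀ w - g| :=
    fun w => abs_sub_comm _ _
  -- The lower deviation is the upper one for the opposite of `U`, with the same envelope `V`.
  obtain ⟨G₂, hG₂, hμ₂, hb₂⟩ := exists_event_sum_clamp_le hmeas hlaw hind hn hη hout hu hε hε0 hε1
    (U := fun w => g - samplePartial ℓ j θ₀ w)
    hm hα hα1 (hSm.const_sub g) hVm ((integrable_const _).sub hint)
    (by
      have : (fun w => g - samplePartial ℓ j θ₀ w) = fun w => -(samplePartial ℓ j θ₀ w - g) := by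
        ext w
        ring
      rw [this, integral_neg, hU0, neg_zero])
    (by simpa only [hneg] using hUi) (by simpa only [hneg] using hU) hv hV0 hVi hV
  refine ⟨G₁ ∩ G₂, hG₁.inter hG₂, ?_, ?_⟩
  · rw [Set.compl_inter]
    calc μ (G₁ᶜ ∪ G₂ᶜ) ≤ μ G₁ᶜ + μ G₂ᶜ := measure_union_le _ _
      _ ≤ 3 * ENNReal.ofReal (Real.exp (-(5 * u))) + 3 * ENNReal.ofReal (Real.exp (-(5 * u))) := by
        gcongr
      _ = _ := by
        rw [← add_mul]
        norm_num
  · intro ω hω θ hθ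
    have hdev : ∀ i, |samplePartial ℓ j θ (Z i ω) - samplePartial ℓ j θ₀ (Z i ω)| ≤ V (Z i ω) :=
      fun i => (hloss.abs_samplePartial_sub_le j θ θ₀ (Z i ω)).trans
        (mul_le_mul_of_nonneg_left hθ (by positivity))
    have hηn : 0 ≤ η * n := by positivity
    obtain ⟨c1, c2, c3, c4⟩ := orderStat_counts (v := fun i => samplePartial ℓ j θ (Z i ω))
      hn hε0 hε1 (by linarith)
    rw [abs_sub_le_iff]
    constructor
    · refine trimmedMean_sub_le hn hn0 (hb₁ ω hω.1 _ _ _ (fun i _ => ?_) (fun t ht => ?_)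
        fun t ht => ?_)
      · have := (abs_le.1 (hdev i)).2
        linarith
      · have h := c1 (t + g) (by linarith)
        simpa only [lt_sub_iff_add_lt] using h
      · have h := c2 (t + g) (by linarith)
        simpa only [sub_le_iff_le_add] using h
    · refine sub_trimmedMean_le hn hn0 (hb₂ ω hω.2 _ _ _ (fun i _ => ?_) (fun t ht => ?_)
        fun t ht => ?_)
      · have := (abs_le.1 (hdev i)).1
        linarith
      · have h := c3 (g - t) (by linarith)
        simpa only [lt_sub_comm] using h
      · have h := c4 (g - t) (by linarith)
        simpa only [sub_le_comm] using h

theorem abs_riskPartial_sub_le (hloss : LossAssumption ℓ γ q)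
    (h2 : Integrable (fun w => ‖w.1‖ ^ 2) P) {j : Fin d} {θ θ' : Vec d}
    (hθ : Integrable (samplePartial ℓ j θ) P) (hθ' : Integrable (samplePartial ℓ j θ') P) :
    |∫ w, samplePartial ℓ j θ w ∂P - ∫ w, samplePartial ℓ j θ' w ∂P| ≤
      meanSmoothness P γ * ‖θ - θ'‖ := by
  rw [← integral_sub hθ hθ', meanSmoothness, ← integral_const_mul, ← integral_mul_const]
  refine abs_integral_le_integral_abs.trans (integral_mono (hθ.sub hθ').abs
    ((h2.const_mul γ).mul_const _) fun w => hloss.abs_samplePartial_sub_le j θ θ' w)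

end Uniform

/-! ### The size of the net against the trimming level -/

section Numeric

/-- The first logarithm is at least `2 log 2`, the second at least `log 3 > 1`. -/
theorem complexity_lower_bound {d : ℕ} (hd : 1 ≤ d) {δ x : ℝ} (hδ0 : 0 < δ) (hδ1 : δ < 1)
    (hx : 2 ≤ x) : 2.38 ≤ Real.log (4 * d / δ) + d * Real.log (3 * x / 2) := by
  have hd' : (1 : ℝ) ≤ d := by exact_mod_cast hd
  have h1 : Real.log 4 ≤ Real.log (4 * d / δ) := by
    refine Real.log_le_log (by norm_num) ?_
    rw [le_div_iff₀ hδ0]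
    nlinarith
  have h2 : Real.log 4 = 2 * Real.log 2 := by
    rw [show (4 : ℝ) = 2 ^ 2 by norm_num, Real.log_pow]
    norm_num
  have h3 : 1 ≤ Real.log (3 * x / 2) := by
    rw [Real.le_log_iff_exp_le (by linarith)]
    linarith [Real.exp_one_lt_d9]
  have h4 := Real.log_two_gt_d9
  have h5 : 1 * 1 ≤ d * Real.log (3 * x / 2) := mul_le_mul hd' h3 zero_le_one (by linarith)
  linarith

/-- The fifth powers dominate: `(3x/2)^5 ≥ 81 * 3x/2 ≥ 1 + 120x` absorbs the net, and `(4d/δ)^5 ≥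
6/δ` leaves `δ`. -/
theorem net_card_mul_exp_le {d : ℕ} (hd : 1 ≤ d) {δ x K : ℝ} (hδ0 : 0 < δ) (hδ1 : δ < 1)
    (hx : 2 ≤ x) (hK : K ≤ (1 + 120 * x) ^ d) :
    K * (6 * Real.exp (-(5 * (Real.log (4 * d / δ) + d * Real.log (3 * x / 2))))) ≤ δ := by
  have hd' : (1 : ℝ) ≤ d := by exact_mod_cast hd
  have hb : 0 < 4 * (d : ℝ) / δ := by positivity
  have hc : 0 < 3 * x / 2 := by linarith
  have he : Real.exp (-(5 * (Real.log (4 * d / δ) + d * Real.log (3 * x / 2)))) =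
      ((4 * d / δ) ^ 5)⁻¹ * (((3 * x / 2) ^ 5) ^ d)⁻¹ := by
    have : -(5 * (Real.log (4 * d / δ) + d * Real.log (3 * x / 2))) =
        -Real.log ((4 * d / δ) ^ 5) + -Real.log (((3 * x / 2) ^ 5) ^ d) := by
      rw [Real.log_pow, Real.log_pow, Real.log_pow]
      push_cast
      ring
    rw [this, Real.exp_add, Real.exp_neg, Real.exp_neg, Real.exp_log (by positivity),
      Real.exp_log (by positivity)]
  have hKle : K ≤ ((3 * x / 2) ^ 5) ^ d := by
    refine hK.trans (pow_le_pow_left₀ (by linarith) ?_ d)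
    have h4 : (3 : ℝ) ^ 4 ≤ (3 * x / 2) ^ 4 := pow_le_pow_left₀ (by norm_num) (by linarith) 4
    have h5 : (3 * x / 2) ^ 5 = (3 * x / 2) ^ 4 * (3 * x / 2) := pow_succ _ _
    rw [h5]
    nlinarith
  have hδle : ((4 * d / δ) ^ 5)⁻¹ ≤ δ / 6 := by
    have h1 : 4 / δ ≤ 4 * d / δ := by
      gcongr
      linarith
    have h2 : (4 / δ) ^ 5 ≤ (4 * d / δ) ^ 5 := pow_le_pow_left₀ (by positivity) h1 5
    have h3 : 6 / δ ≤ (4 / δ) ^ 5 := by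
      rw [div_pow, div_le_div_iff₀ hδ0 (by positivity)]
      have : δ ^ 5 ≤ δ := by
        have := pow_le_pow_of_le_one hδ0.le hδ1.le (show 1 ≤ 5 by norm_num)
        simpa using this
      nlinarith
    calc ((4 * d / δ) ^ 5)⁻¹ ≤ (6 / δ)⁻¹ := inv_anti₀ (by positivity) (h3.trans h2)
      _ = δ / 6 := inv_div _ _
  rw [he]
  calc K * (6 * (((4 * d / δ) ^ 5)⁻¹ * (((3 * x / 2) ^ 5) ^ d)⁻¹))
      ≤ ((3 * x / 2) ^ 5) ^ d * (6 * (δ / 6 * (((3 * x / 2) ^ 5) ^ d)⁻¹)) := by gcongr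
    _ = δ := by field_simp

end Numeric

/-! ### Union bound over the net -/

section Main

variable {d n : ℕ} {𝒴 : Set ℝ} {Ω : Type*} [MeasurableSpace Ω] {μ : Measure Ω}
  {P : Measure (Vec d × 𝒴)} {ℓ : ℝ → 𝒴 → ℝ} {γ q α η δ : ℝ} {Z : Fin n → Ω → Vec d × 𝒴}

theorem pos_of_two_le_mul_rpow {n : ℕ} {Δ α : ℝ} (hα : 0 < α)
    (hnet : 2 ≤ Δ * (n : ℝ) ^ (α / (1 + α))) : 0 < n := by
  rcases Nat.eq_zero_or_pos n with h | h
  · rw [h, Nat.cast_zero, Real.zero_rpow (by positivity), mul_zero] at hnet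
    norm_num at hnet
  · exact h

theorem trimLevel_pos {d n : ℕ} {Δ α δ η : ℝ} (hα : 0 < α) (hδ₀ : 0 < δ) (hδ₁ : δ < 1)
    (hη₀ : 0 ≤ η) (hd : 1 ≤ d) (hnet : 2 ≤ Δ * (n : ℝ) ^ (α / (1 + α))) :
    0 < trimLevel d n Δ α δ η := by
  have hn : (0 : ℝ) < n := by exact_mod_cast pos_of_two_le_mul_rpow hα hnet
  have hu := complexity_lower_bound hd hδ₀ hδ₁ hnet
  rw [← mul_assoc] at hu
  have : 0 < complexityTerm d n Δ α δ := div_pos (by linarith) hn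
  rw [trimLevel]
  linarith

/-- The uniform deviation bound for the trimmed mean, over a finite bound `M` on the moments. -/
theorem exists_event_uniform [IsProbabilityMeasure μ] [IsProbabilityMeasure P]
    {Θ : Set (Vec d)} {inliers outliers : Finset (Fin n)}
    (hα₀ : 0 < α) (hα₁ : α ≤ 1) (hδ₀ : 0 < δ) (hδ₁ : δ < 1) (hη₀ : 0 ≤ η)
    (hΘcomp : IsCompact Θ) (hΘzero : 0 ∈ Θ) (hloss : LossAssumption ℓ γ q)
    (hdata : DataAssumption μ P Z inliers outliers q α) (hout : (outliers.card : ℝ) ≤ η * n)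
    (hn : Even n) (hnet : 2 ≤ Metric.diam Θ * (n : ℝ) ^ (α / (1 + α)))
    (htrim : trimLevel d n (Metric.diam Θ) α δ η < 1 / 2) (j : Fin d) {L : ℝ} (hL₀ : 0 < L)
    {M : ℝ} (hM : 0 ≤ M) (hMΘ : ∀ θ ∈ Θ, partialMoment ℓ P α j θ ≤ ENNReal.ofReal M) :
    ∃ G : Set Ω, MeasurableSet G ∧ ENNReal.ofReal (1 - δ) ≤ μ G ∧ ∀ ω ∈ G, ∀ θ ∈ Θ,
      |gradTM ℓ (trimLevel d n (Metric.diam Θ) α δ η) (fun i => Z i ω) j θ - riskPartial ℓ P j θ| ≤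
        28 * M ^ (1 / (1 + α)) *
          (trimLevel d n (Metric.diam Θ) α δ η / 4) ^ (α / (1 + α)) +
        (meanSmoothness P γ + L) / (n : ℝ) ^ (α / (1 + α)) := by
  classical
  have hd : 1 ≤ d := (Nat.zero_le _).trans_lt j.2
  have hβ0 : 0 < α / (1 + α) := by positivity
  have hn0 : 0 < n := pos_of_two_le_mul_rpow hα₀ hnet
  have hn0' : (0 : ℝ) < n := by exact_mod_cast hn0
  set Δ := Metric.diam Θ with hΔ
  set ε := trimLevel d n Δ α δ η with hεdef
  set ρ := (n : ℝ) ^ (α / (1 + α)) with hρ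
  have hρ0 : 0 < ρ := Real.rpow_pos_of_pos hn0' _
  set x := Δ * ρ with hx
  set u := Real.log (4 * d / δ) + d * Real.log (3 * x / 2) with hu
  have hu2 : 2.38 ≤ u := complexity_lower_bound hd hδ₀ hδ₁ hnet
  have hεu : ε * (n / 2) = 4 * η * n + 6 * u := by
    rw [hεdef, trimLevel, complexityTerm, hu, hx, ← mul_assoc]
    field_simp
    ring
  have hηn : 0 ≤ η * n := by positivity
  have hε0 : 0 < ε := by
    rw [hεdef]
    exact trimLevel_pos hα₀ hδ₀ hδ₁ hη₀ hd hnet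
  have h2 := integrable_sq_norm hdata.moment_feature
  have hint := fun θ => hloss.integrable_samplePartial hα₀ h2 j (hdata.moment_product j) θ
  have hrisk := hloss.riskPartial_eq hα₀ h2 j (hdata.moment_product j) hdata.moment_label
  have hcompl : (inliersᶜ.card : ℝ) ≤ η * n := by
    refine le_trans ?_ hout
    have : inliersᶜ ⊆ outliers := fun i hi => by
      have h := Finset.mem_univ i
      rw [← hdata.union, Finset.mem_union] at h
      exact h.resolve_left (Finset.mem_compl.1 hi)
    exact_mod_cast Finset.card_le_card this
  have hne : Nonempty (Vec d × 𝒴) := P.nonempty_of_neZero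
  have : Nonempty 𝒴 := hne.map Prod.snd
  have hγ := hloss.nonneg_smoothness
  have hLbar : 0 ≤ meanSmoothness P γ :=
    mul_nonneg hγ (integral_nonneg fun w => by positivity)
  set s := (meanSmoothness P γ + L) / ρ with hs
  have hs0 : 0 < s := by positivity
  set r := 1 / (60 * ρ) with hr
  have hr0 : 0 < r := by positivity
  -- `L > 0` makes `v` positive even when the mean smoothness vanishes.
  set v := s / 60 with hv
  have hv0 : 0 < v := by positivity
  have hrv : meanSmoothness P γ * r ≤ v := by
    have : v = (meanSmoothness P γ + L) * r := by
      rw [hv, hs, hr]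
      field_simp
    rw [this]
    gcongr
    linarith
  -- The small multiple of `s` keeps `m` positive when `M = 0`.
  set m := M ^ (1 / (1 + α)) + 0.001 * s with hm
  have hM' : 0 ≤ M ^ (1 / (1 + α)) := Real.rpow_nonneg hM _
  have hm0 : 0 < m := by positivity
  have hMm : M ≤ m ^ (1 + α) := by
    calc M = (M ^ (1 / (1 + α))) ^ (1 + α) := by
          rw [← Real.rpow_mul hM, one_div_mul_cancel (by positivity), Real.rpow_one]
      _ ≤ m ^ (1 + α) := Real.rpow_le_rpow hM' (by linarith) (by linarith)
  obtain ⟨T, hTΘ, hTnet, hTcard⟩ := exists_finset_net Metric.diam_nonneg hr0 Θ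
    (fun θ hθ => by
      have := Metric.dist_le_diam_of_mem hΘcomp.isBounded hθ hΘzero
      rwa [dist_zero_right] at this)
  rw [finrank_euclideanSpace_fin] at hTcard
  have hTcard' : (T.card : ℝ) ≤ (1 + 120 * x) ^ d := by
    refine hTcard.trans_eq ?_
    congr 2
    rw [hr, hx, hΔ]
    field_simp
    ring
  have hlocal : ∀ θ₀ : Vec d, ∃ G : Set Ω, MeasurableSet G ∧ (θ₀ ∈ T →
      μ Gᶜ ≤ 6 * ENNReal.ofReal (Real.exp (-(5 * u))) ∧
      ∀ ω ∈ G, ∀ θ : Vec d, ‖θ - θ₀‖ ≤ r →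
        |gradTM ℓ ε (fun i => Z i ω) j θ - ∫ w', samplePartial ℓ j θ₀ w' ∂P| ≤
          27.6 * (m * (ε / 4) ^ (α / (1 + α))) + 56.2 * v) := by
    intro θ₀
    by_cases hmem : θ₀ ∈ T
    · obtain ⟨hUi, hU⟩ := integrable_rpow_of_partialMoment_le hloss hM (hMΘ θ₀ (hTΘ hmem))
      obtain ⟨G, hG, hG'⟩ := exists_event_local hdata.measurable hdata.law hdata.indep hn hn0 hη₀
        hcompl hu2 hεu hε0 htrim hα₀ hα₁ hloss h2 (hint θ₀) hm0 hUi (hU.trans hMm) hr0.le hv0 hrv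
      exact ⟨G, hG, fun _ => hG'⟩
    -- Off the net the event is arbitrary; a total function allows `choose`.
    · exact ⟨∅, .empty, fun h => absurd h hmem⟩
  choose G hG hG' using hlocal
  refine ⟨⋂ θ₀ ∈ T, G θ₀, Finset.measurableSet_biInter T fun θ₀ _ => hG θ₀, ?_, ?_⟩
  · have hbad : μ (⋂ θ₀ ∈ T, G θ₀)ᶜ ≤ ENNReal.ofReal δ := by
      rw [Set.compl_iInter₂]
      calc μ (⋃ θ₀ ∈ T, (G θ₀)ᶜ) ≤ ∑ θ₀ ∈ T, μ (G θ₀)ᶜ := measure_biUnion_finset_le _ _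
        _ ≤ ∑ _θ₀ ∈ T, 6 * ENNReal.ofReal (Real.exp (-(5 * u))) :=
          Finset.sum_le_sum fun θ₀ hθ₀ => (hG' θ₀ hθ₀).1
        _ = ENNReal.ofReal (T.card * (6 * Real.exp (-(5 * u)))) := by
          rw [Finset.sum_const, nsmul_eq_mul, ENNReal.ofReal_mul (by positivity),
            ENNReal.ofReal_mul (by norm_num)]
          simp
        _ ≤ ENNReal.ofReal δ := by
          refine ENNReal.ofReal_le_ofReal ?_
          have := net_card_mul_exp_le hd hδ₀ hδ₁ hnet hTcard'
          exact this
    have hmeasG : MeasurableSet (⋂ θ₀ ∈ T, G θ₀) :=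
      Finset.measurableSet_biInter T fun θ₀ _ => hG θ₀
    rw [← compl_compl (⋂ θ₀ ∈ T, G θ₀), prob_compl_eq_one_sub hmeasG.compl,
      ENNReal.ofReal_sub _ hδ₀.le, ENNReal.ofReal_one]
    exact tsub_le_tsub_left hbad 1
  · intro ω hω θ hθ
    obtain ⟨θ₀, hθ₀, hdist⟩ := hTnet θ hθ
    have h3 := (hG' θ₀ hθ₀).2 ω (Set.mem_iInter₂.1 hω θ₀ hθ₀) θ hdist
    have h4 := (abs_riskPartial_sub_le hloss h2 (hint θ₀) (hint θ)).trans
      ((mul_le_mul_of_nonneg_left (by rwa [norm_sub_rev]) hLbar).trans hrv)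
    rw [hrisk θ]
    have h5 := abs_sub_le (gradTM ℓ ε (fun i => Z i ω) j θ) (∫ w, samplePartial ℓ j θ₀ w ∂P)
      (∫ w, samplePartial ℓ j θ w ∂P)
    have h6 : (ε / 4) ^ (α / (1 + α)) ≤ 1 :=
      Real.rpow_le_one (by positivity) (by linarith) hβ0.le
    have h7 : 0 ≤ (ε / 4) ^ (α / (1 + α)) := by positivity
    have h8 : s * (ε / 4) ^ (α / (1 + α)) ≤ s := mul_le_of_le_one_right hs0.le h6
    have h9 : 0 ≤ M ^ (1 / (1 + α)) * (ε / 4) ^ (α / (1 + α)) := mul_nonneg hM' h7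
    have h10 : m * (ε / 4) ^ (α / (1 + α)) =
        M ^ (1 / (1 + α)) * (ε / 4) ^ (α / (1 + α)) +
          0.001 * (s * (ε / 4) ^ (α / (1 + α))) := by
      rw [hm]
      ring
    rw [h10] at h3
    rw [mul_assoc 28]
    -- The coefficient of `s` is `27.6 * 0.001 + 56.2 / 60 + 1 / 60 < 1`, the last term being the
    -- drift of `g_j` from `θ₀` to `θ`.
    linarith

theorem ofReal_le_errorTM {Θ : Set (Vec d)} (hα₀ : 0 < α) {j : Fin d} {L : ℝ}
    (htrim : 0 < trimLevel d n (Metric.diam Θ) α δ η)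
    (hM : maxPartialMoment ℓ P Θ α j ≠ ⊤) :
    ENNReal.ofReal (28 * (maxPartialMoment ℓ P Θ α j).toReal ^ (1 / (1 + α)) *
        (trimLevel d n (Metric.diam Θ) α δ η / 4) ^ (α / (1 + α)) +
        (meanSmoothness P γ + L) / (n : ℝ) ^ (α / (1 + α))) ≤
      errorTM n ℓ P Θ γ α δ η L j := by
  set M := maxPartialMoment ℓ P Θ α j
  have h4 : trimLevel d n (Metric.diam Θ) α δ η / 4 =
      2 * η + 3 * complexityTerm d n (Metric.diam Θ) α δ := by
    rw [trimLevel]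
    ring
  have hpos : 0 ≤ trimLevel d n (Metric.diam Θ) α δ η / 4 := by positivity
  rw [errorTM, ← h4]
  refine ENNReal.ofReal_add_le.trans (add_le_add ?_ le_rfl)
  have hM0 : 0 ≤ M.toReal ^ (1 / (1 + α)) := Real.rpow_nonneg ENNReal.toReal_nonneg _
  rw [ENNReal.ofReal_mul (by positivity), ENNReal.ofReal_mul (by norm_num),
    ← ENNReal.ofReal_rpow_of_nonneg ENNReal.toReal_nonneg (by positivity),
    ← ENNReal.ofReal_rpow_of_nonneg hpos (by positivity), ENNReal.ofReal_toReal hM,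
    show ENNReal.ofReal 28 = 28 by simp]
  gcongr
  exact le_self_add

/-- Positivity of the trimming level matters because `⊤ * 0 = 0` in `ℝ≥0∞`. -/
theorem errorTM_eq_top {Θ : Set (Vec d)} (hα₀ : 0 < α) {j : Fin d} {L : ℝ}
    (htrim : 0 < trimLevel d n (Metric.diam Θ) α δ η)
    (hM : maxPartialMoment ℓ P Θ α j = ⊤) :
    errorTM n ℓ P Θ γ α δ η L j = ⊤ := by
  have h4 : 0 < 2 * η + 3 * complexityTerm d n (Metric.diam Θ) α δ := by
    rw [trimLevel] at htrim
    linarith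
  have h1 : ENNReal.ofReal (2 * η + 3 * complexityTerm d n (Metric.diam Θ) α δ) ^
      (α / (1 + α)) ≠ 0 := by
    rw [ENNReal.ofReal_rpow_of_pos h4]
    exact (ENNReal.ofReal_pos.2 (Real.rpow_pos_of_pos h4 _)).ne'
  rw [errorTM, hM, top_add, ENNReal.top_rpow_of_pos (by positivity),
    ENNReal.mul_top (by norm_num), ENNReal.top_mul h1, top_add]

end Main

end TrimmedGradient

theorem proposition3 {d n : ℕ} {𝒴 : Set ℝ} {Ω : Type*} [MeasurableSpace Ω]
    (μ : Measure Ω) [IsProbabilityMeasure μ]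
    (P : Measure (TrimmedGradient.Vec d × 𝒴)) [IsProbabilityMeasure P]
    (ℓ : ℝ → 𝒴 → ℝ) (γ q α η δ : ℝ) (Θ : Set (TrimmedGradient.Vec d))
    (Z : Fin n → Ω → TrimmedGradient.Vec d × 𝒴) (inliers outliers : Finset (Fin n))
    (hα₀ : 0 < α) (hα₁ : α ≤ 1) (hδ₀ : 0 < δ) (hδ₁ : δ < 1) (hη₀ : 0 ≤ η) (hη₁ : η < 1 / 2)
    (hΘconv : Convex ℝ Θ) (hΘcomp : IsCompact Θ) (hΘzero : 0 ∈ Θ)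
    (hloss : TrimmedGradient.LossAssumption ℓ γ q)
    (hdata : TrimmedGradient.DataAssumption μ P Z inliers outliers q α)
    (hout : (outliers.card : ℝ) ≤ η * n)
    (hn : Even n)
    (hnet : 2 ≤ Metric.diam Θ * (n : ℝ) ^ (α / (1 + α)))
    (htrim : TrimmedGradient.trimLevel d n (Metric.diam Θ) α δ η < 1 / 2)
    (j : Fin d) (L : ℝ) (hL₀ : 0 < L) (hL : TrimmedGradient.IsCoordLipschitz ℓ P Θ j L) :
    ∃ G : Set Ω, MeasurableSet G ∧ ENNReal.ofReal (1 - δ) ≤ μ G ∧ ∀ ω ∈ G,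
      (⨆ θ ∈ Θ, ENNReal.ofReal
          |TrimmedGradient.gradTM ℓ (TrimmedGradient.trimLevel d n (Metric.diam Θ) α δ η)
              (fun i => Z i ω) j θ
            - TrimmedGradient.riskPartial ℓ P j θ|)
        ≤ TrimmedGradient.errorTM n ℓ P Θ γ α δ η L j := by
  have hd : 1 ≤ d := (Nat.zero_le _).trans_lt j.2
  have hpos := TrimmedGradient.trimLevel_pos hα₀ hδ₀ hδ₁ hη₀ hd hnet
  by_cases hM : TrimmedGradient.maxPartialMoment ℓ P Θ α j = ⊤
  -- With an infinite moment the bound is `⊤`, so the whole space serves.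
  · refine ⟨Set.univ, .univ, ?_, fun ω _ => ?_⟩
    · rw [measure_univ]
      exact ENNReal.ofReal_le_one.2 (by linarith)
    · rw [TrimmedGradient.errorTM_eq_top hα₀ hpos hM]
      exact le_top
  · obtain ⟨G, hG, hμ, hb⟩ := TrimmedGradient.exists_event_uniform hα₀ hα₁ hδ₀ hδ₁ hη₀ hΘcomp hΘzero
      hloss hdata hout hn hnet htrim j hL₀ ENNReal.toReal_nonneg fun θ hθ => by
        rw [ENNReal.ofReal_toReal hM]
        exact le_iSup₂ (f := fun θ _ => TrimmedGradient.partialMoment ℓ P α j θ) θ hθ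
    exact ⟨G, hG, hμ, fun ω hω => iSup₂_le fun θ hθ =>
      (ENNReal.ofReal_le_ofReal (hb ω hω θ hθ)).trans
        (TrimmedGradient.ofReal_le_errorTM hα₀ hpos hM)⟩
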